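/- Let $n\ge 1$ be an integer and $[n]=\{1,\dots,n\}$, and let $\mathbf e_1,\dots,\mathbf e_n$ be the standard basis of $\mathbb R^n$. A \emph{polymatroid} is a finite nonempty set $P\subset\mathbb Z^n$ such that for all $\mathbf a,\mathbf b\in P$ and all $i\in[n]$ with $a_i>b_i$ there is $j\in[n]$ with $a_j<b_j$ such that both $\mathbf a-\mathbf e_i+\mathbf e_j$ and $\mathbf b+\mathbf e_i-\mathbf e_j$ belong to $P$ (for $n=0$, the one-point set $\mathbb Z^0$ is a polymatroid, too). Its rank function is $f(I)=\max_{\mathbf a\in P}\sum_{i\in I}a_i$ for $I\subseteq[n]$. For $\mathbf a\in P$, let $\mathrm{Int}(\mathbf a)$ (respectively $\mathrm{Ext}(\mathbf a)$) be the set of $i\in[n]$ for which there is no $j<i$ with $\mathbf a-\mathbf e_i+\mathbf e_j\in P$ (respectively $\mathbf a+\mathbf e_i-\mathbf e_j\in P$). The \emph{polymatroid Tutte polynomial} of $P$ is $$\mathscr T_P(x,y)=\sum_{\mathbf a\in P}x^{|\mathrm{Int}(\mathbf a)\setminus\mathrm{Ext}(\mathbf a)|}\,y^{|\mathrm{Ext}(\mathbf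 a)\setminus\mathrm{Int}(\mathbf a)|}\,(x+y-1)^{|\mathrm{Int}(\mathbf a)\cap\mathrm{Ext}(\mathbf a)|}\in\mathbb Z[x,y].$$ For polymatroids $P\subset\mathbb Z^n$ and $Q\subset\mathbb Z^m$ with $n,m\ge1$, put $$P\oplus Q=\{(a_1,\dots,a_n,b_1,\dots,b_m)\mid \mathbf a\in P,\ \mathbf b\in Q\}\subset\mathbb Z^{n+m},$$ $$P\boxplus Q=\{(a_1+b_1,a_2,\dots,a_n,b_2,\dots,b_m)\mid \mathbf a\in P,\ \mathbf b\in Q\}\subset\mathbb Z^{n+m-1}.$$ Let $n\ge1$, let $P\subset\mathbb Z^n$ be a polymatroid with rank function $f$, let $\mathcal P=\mathrm{conv}(P)\subset\mathbb R^n$, and let $\mathrm{codim}(P)=n-\dim(\mathcal P)$. Then the following hold. (a) $\mathscr T_P(x,y)$ has total degree $n$. (b) The coefficients of $\mathscr T_P(x,y+1)$ and of $\mathscr T_P(x+1,y)$ are non-negative integers, but $\mathscr T_P(x,y)$ always has both positive and negative coefficients. (c) $\mathscr T_P(x,y)$ is divisible by $(x+y-1)^{\mathrm{codim}(P)}$ in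 $\mathbb Z[x,y]$. (d) The top homogeneous component of $\mathscr T_P(x,y)$ (that of degree $n$) equals $(x+y)^n$. Equivalently, for $0\le k\le n$ the coefficient of $x^ky^{n-k}$ in $\mathscr T_P(x,y)$ is $\binom nk$. (e) For every polymatroid $Q\subset\mathbb Z^m$ with $m\ge1$, the sets $P\oplus Q$ and $P\boxplus Q$ are polymatroids, and $$\mathscr T_{P\oplus Q}(x,y)=\mathscr T_P(x,y)\,\mathscr T_Q(x,y),\qquad \mathscr T_{P\boxplus Q}(x,y)=\frac{\mathscr T_P(x,y)\,\mathscr T_Q(x,y)}{x+y-1}.$$ (f) Let $i\in[n]$. For $\mathbf a\in\mathbb Z^n$ let $\widehat{\mathbf a}^i\in\mathbb Z^{n-1}$ be $\mathbf a$ with its $i$-th coordinate omitted, and let $r_i=f(\{i\})+f([n]\setminus\{i\})-f([n])$. If $r_i=0$, then $\widehat P^i:=\{\widehat{\mathbf a}^i\mid\mathbf a\in P\}$ is a polymatroid and $$\mathscr T_P(x,y)=(x+y-1)\,\mathscr T_{\widehat P^i}(x,y).$$ If $r_i=1$, then $P\setminus i:=\{\widehat{\mathbf a}^i\mid\mathbf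 a\in P,\ a_i=f(\{i\})-1\}$ and $P/i:=\{\widehat{\mathbf a}^i\mid\mathbf a\in P,\ a_i=f(\{i\})\}$ are polymatroids and $$\mathscr T_P(x,y)=x\,\mathscr T_{P\setminus i}(x,y)+y\,\mathscr T_{P/i}(x,y).$$ (g) $\mathscr T_P(1,1)=|P|=|\mathcal P\cap\mathbb Z^n|$ and $\mathscr T_P(0,0)=(-1)^{\mathrm{codim}(P)}\,|\mathcal P^\circ\cap\mathbb Z^n|$, where $\mathcal P^\circ$ is the relative interior of $\mathcal P$ (its interior in its affine span). (h) Let $\Delta=\mathrm{conv}(\mathbf e_1,\dots,\mathbf e_n)$ and $\nabla=\mathrm{conv}(-\mathbf e_1,\dots,-\mathbf e_n)$, and put $\mathcal P-\Delta=\{\mathbf a\in\mathbb R^n\mid\mathbf a+\Delta\subseteq\mathcal P\}$ and $\mathcal P-\nabla=\{\mathbf a\in\mathbb R^n\mid\mathbf a+\nabla\subseteq\mathcal P\}$. Then $\mathscr T_P(x,y)$ is divisible by $x+y-1$ in $\mathbb Z[x,y]$, both sets contain only finitely many lattice points, and $$\frac{\mathscr T_P(x,y)}{x+y-1}\bigg|_{x=1,\,y=0}=|(\mathcal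 P-\Delta)\cap\mathbb Z^n|,\qquad \frac{\mathscr T_P(x,y)}{x+y-1}\bigg|_{x=0,\,y=1}=|(\mathcal P-\nabla)\cap\mathbb Z^n|.$$ -/

import Mathlib

noncomputable section

namespace PolymatroidTutte

open MvPolynomial

/-- A polymatroid in `ℤⁿ`: a finite nonempty M-convex set, that is, a finite nonempty set of integer
vectors satisfying the (symmetric) Exchange Axiom. -/
structure IsPolymatroid {n : ℕ} (P : Finset (Fin n → ℤ)) : Prop where
  nonempty : P.Nonempty
  exchange : ∀ a ∈ P, ∀ b ∈ P, ∀ i : Fin n, b i < a i →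
    ∃ j : Fin n, a j < b j ∧
      a - Pi.single i 1 + Pi.single j 1 ∈ P ∧ b + Pi.single i 1 - Pi.single j 1 ∈ P

/-- The rank function `f(I) = max_{a ∈ P} ∑_{i ∈ I} a_i`. -/
def rankFn {n : ℕ} (P : Finset (Fin n → ℤ)) (hP : P.Nonempty) (I : Finset (Fin n)) : ℤ :=
  P.sup' hP fun a => ∑ i ∈ I, a i

/-- The set `Int_P(a)` of internally active indices. -/
def intAct {n : ℕ} (P : Finset (Fin n → ℤ)) (a : Fin n → ℤ) : Finset (Fin n) :=
  {i | ¬ ∃ j, j < i ∧ a - Pi.single i 1 + Pi.single j 1 ∈ P}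

/-- The set `Ext_P(a)` of externally active indices. -/
def extAct {n : ℕ} (P : Finset (Fin n → ℤ)) (a : Fin n → ℤ) : Finset (Fin n) :=
  {i | ¬ ∃ j, j < i ∧ a + Pi.single i 1 - Pi.single j 1 ∈ P}

/-- The polymatroid Tutte polynomial, in the variables `x = X 0` and `y = X 1`. -/
def tutte {n : ℕ} (P : Finset (Fin n → ℤ)) : MvPolynomial (Fin 2) ℤ :=
  ∑ a ∈ P, X 0 ^ (intAct P a \ extAct P a).card * X 1 ^ (extAct P a \ intAct P a).card *
    (X 0 + X 1 - 1) ^ (intAct P a ∩ extAct P a).card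

/-- The inclusion `ℤⁿ ⊂ ℝⁿ`. -/
def toReal {n : ℕ} (a : Fin n → ℤ) : Fin n → ℝ := fun i => (a i : ℝ)

/-- The generalized permutohedron `conv(P)`. -/
def polytope {n : ℕ} (P : Finset (Fin n → ℤ)) : Set (Fin n → ℝ) :=
  convexHull ℝ (toReal '' (P : Set (Fin n → ℤ)))

/-- The codimension `n - dim(conv(P))`. -/
def codim {n : ℕ} (P : Finset (Fin n → ℤ)) : ℕ :=
  n - Module.finrank ℝ (vectorSpan ℝ (polytope P))

/-- The lattice points `S ∩ ℤⁿ` of a set `S ⊂ ℝⁿ`. -/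
def latticePoints {n : ℕ} (S : Set (Fin n → ℝ)) : Set (Fin n → ℤ) := {a | toReal a ∈ S}

/-- The direct sum `P ⊕ Q`: all the concatenations of an element of `P` and an element of `Q`. -/
def directSum {n m : ℕ} (P : Finset (Fin n → ℤ)) (Q : Finset (Fin m → ℤ)) :
    Finset (Fin (n + m) → ℤ) :=
  Finset.image₂ Fin.append P Q

/-- The aggregated sum `P ⊞ Q`: all the vectors `(a₁ + b₁, a₂, …, b₂, …)` with `a ∈ P`, `b ∈ Q`.
If `P ⊂ ℤⁿ⁺¹` and `Q ⊂ ℤᵐ⁺¹`, it lies in `ℤⁿ⁺ᵐ⁺¹`. -/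
def aggregatedSum {n m : ℕ} (P : Finset (Fin (n + 1) → ℤ)) (Q : Finset (Fin (m + 1) → ℤ)) :
    Finset (Fin (n + m + 1) → ℤ) :=
  Finset.image₂ (fun a b => Fin.cons (a 0 + b 0) (Fin.append (Fin.tail a) (Fin.tail b))) P Q

/-- The set of the vectors of `P` with their `i`-th coordinate omitted. -/
def project {n : ℕ} (P : Finset (Fin (n + 1) → ℤ)) (i : Fin (n + 1)) : Finset (Fin n → ℤ) :=
  P.image fun a => i.removeNth a

/-- The Minkowski difference `S - D = {a | a + D ⊆ S}`. -/
def minkowskiDiff {n : ℕ} (S D : Set (Fin n → ℝ)) : Set (Fin n → ℝ) :=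
  {a | ∀ d ∈ D, a + d ∈ S}

/-- The standard simplex `conv(e₁, …, eₙ)`. -/
def simplex (n : ℕ) : Set (Fin n → ℝ) :=
  convexHull ℝ (Set.range fun i : Fin n => (Pi.single i 1 : Fin n → ℝ))

/-- The reversed simplex `conv(-e₁, …, -eₙ)`. -/
def revSimplex (n : ℕ) : Set (Fin n → ℝ) :=
  convexHull ℝ (Set.range fun i : Fin n => -(Pi.single i 1 : Fin n → ℝ))

end PolymatroidTutte

end

open MvPolynomial PolymatroidTutte

/-!
The exchange arrows `i → j` at `a ∈ P`, meaning `a - e_i + e_j ∈ P`, control everything. By the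
exchange axiom they form a preorder (`IsPolymatroid.exch_trans`), and every element of `P` is
reached from `a` by exchanges that are arrows at `a` (`IsPolymatroid.path_induction`). Activities
are statements about arrows to and from smaller indices, and the Tutte polynomial is the sum over
`a ∈ P` of a product of weights, one for each index (`tutte_eq_sum_prod`).

*Recursion.* Only smaller indices matter for activity, so slicing `P` by the value `k` of the last
coordinate writes the Tutte polynomial as the sum of the Tutte polynomials of the slices, with
weight `x` at the minimal `k`, `y` at the maximal one, `1` in between, and `x + y - 1` if there is
only one value. The same recursion holds at every index (`IsPolymatroid.tutte_eq_sum_slice`). By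
induction this amounts to slicing two coordinates in either order. The pairs of values form an
M♮-convex set in `ℤ²`, a hexagon; the two resulting weightings differ only in the corners at the
ends of its diagonal edges, and there the discrepancies cancel, because the face of `P` over such an
edge is a direct sum, so that the double slices along it coincide (`IsMNat.sum_endWt`,
`sum_slice_slice`). Deletion-contraction is the case of one or two values of `k`, and the leading
form `(x + y) ^ n` follows by induction since the weights add up to `x + y` plus a constant.

*Polytope.* A set of indices that is closed under the arrows at `a` gives a coordinate sum that `a`
minimizes. Such sums separate the lattice points outside `P` from `conv(P)`, and they show that the
arrows at `a` are reversible if `a` is in the relative interior; conversely, reversible arrows allow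
every exchange path that starts at `a` to be followed backwards, to the other side of `a`
(`IsPolymatroid.toReal_mem_intrinsicInterior_iff`). In that case the internally active indices are
the minima of the classes of arrows, and their number is the codimension
(`IsPolymatroid.codim_eq_card`); in general at least `codim P` indices are active on both sides
(`codim_le_card`), which gives the power of `x + y - 1`. The value at `(0, 0)` then comes from the
recursion at the last index.

*Signs and quotient.* The index `0` is always active on both sides, so `x + y - 1` divides the Tutte
polynomial, which therefore vanishes at `(1/2, 1/2)` and has a negative coefficient. At `(1, 0)` and
`(0, 1)` the quotient counts the `a` at which `0` is the only externally (internally) active index;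
by transitivity these are the `a` with arrows from (to) `0` to (from) all indices, and `a - e_0`
(`a + e_0`) is then a lattice point of the Minkowski difference.

*Sums.* Activities in `P ⊕ Q` and `P ⊞ Q` are those in the summands, as an exchange between the two
parts is impossible in `P ⊕ Q` and splits into two exchanges through the common index in `P ⊞ Q`.
-/

namespace PolymatroidTutte

/-! ### Exchange arrows -/

/-- There is an exchange arrow from `i` to `j` at `a` if `a - e_i + e_j ∈ P`. For a polymatroid `P`
and `a ∈ P`, the arrows at `a` form a preorder on the set of indices, and they span the tangent cone
of `conv(P)` at `a`. -/
def Exch {n : ℕ} (P : Finset (Fin n → ℤ)) (a : Fin n → ℤ) (i j : Fin n) : Prop :=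
  a - Pi.single i 1 + Pi.single j 1 ∈ P

section Exchange

variable {n : ℕ} {P : Finset (Fin n → ℤ)} {a b : Fin n → ℤ}

lemma exch_iff' {i j : Fin n} : Exch P a i j ↔ a + Pi.single j 1 - Pi.single i 1 ∈ P := by
  rw [Exch, sub_add_eq_add_sub]

lemma mem_intAct {i : Fin n} : i ∈ intAct P a ↔ ∀ j < i, ¬ Exch P a i j := by
  simp [intAct, Exch]

lemma mem_extAct {i : Fin n} : i ∈ extAct P a ↔ ∀ j < i, ¬ Exch P a j i := by
  simp [extAct, exch_iff']

lemma exch_refl (ha : a ∈ P) (i : Fin n) : Exch P a i i := by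
  simpa [Exch] using ha

lemma IsPolymatroid.exch_trans (hP : IsPolymatroid P) (ha : a ∈ P) {i j k : Fin n}
    (h₁ : Exch P a i j) (h₂ : Exch P a j k) : Exch P a i k := by
  by_cases hij : i = j
  · subst hij; exact h₂
  by_cases hjk : j = k
  · subst hjk; exact h₁
  by_cases hik : i = k
  · subst hik; exact exch_refl ha i
  -- exchange at `k`: the only coordinate in which `a - e_j + e_k` is below `a - e_i + e_j` is `j`
  obtain ⟨l, hl, -, hl'⟩ := hP.exchange _ h₂ _ h₁ k (by simp [Ne.symm hik, Ne.symm hjk])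
  have : l = j := by
    by_contra h
    by_cases hli : l = i <;> by_cases hlk : l = k <;> simp_all
    omega
  subst this
  rw [Exch]
  convert hl' using 1
  abel

/-- Any two elements of a polymatroid are joined by exchanges: `b ∈ P` different from `a` can be
moved towards `a` by undoing an exchange that is an arrow at `a`. -/
lemma IsPolymatroid.exists_step (hP : IsPolymatroid P) (ha : a ∈ P) (hb : b ∈ P) (hab : b ≠ a) :
    ∃ i j, b i < a i ∧ a j < b j ∧ Exch P a i j ∧ Exch P b j i := by
  obtain ⟨i, hi⟩ : ∃ i, b i ≠ a i := by
    by_contra! h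
    exact hab (funext h)
  rcases lt_or_gt_of_ne hi with hi | hi
  · obtain ⟨j, hj, h₁, h₂⟩ := hP.exchange a ha b hb i hi
    exact ⟨i, j, hi, hj, h₁, exch_iff'.2 h₂⟩
  · obtain ⟨j, hj, h₁, h₂⟩ := hP.exchange b hb a ha i hi
    exact ⟨j, i, hj, hi, exch_iff'.2 h₂, h₁⟩

/-- Induction along a path of exchanges from `a`, each of which is an arrow at `a`. -/
lemma IsPolymatroid.path_induction (hP : IsPolymatroid P) (ha : a ∈ P)
    {motive : (Fin n → ℤ) → Prop} (base : motive a)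
    (step : ∀ b i j, Exch P a i j → motive (b - Pi.single j 1 + Pi.single i 1) → motive b)
    (hb : b ∈ P) : motive b := by
  induction hN : ∑ k, (b k - a k).natAbs using Nat.strong_induction_on generalizing b with
  | _ N ih =>
    by_cases hab : b = a
    · rwa [hab]
    obtain ⟨i, j, hi, hj, h₁, h₂⟩ := hP.exists_step ha hb hab
    refine step b i j h₁ (ih _ ?_ h₂ rfl)
    rw [← hN]
    have hij : i ≠ j := by rintro rfl; omega
    refine Finset.sum_lt_sum (fun k _ => ?_) ⟨i, Finset.mem_univ _, ?_⟩
    · by_cases hki : k = i <;> by_cases hkj : k = j <;> simp_all <;> omega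
    · simp [hij]; omega

/-- If a set `U` of indices is closed under the arrows at `a`, then `a` minimizes the sum of the
coordinates in `U`. -/
lemma IsPolymatroid.sum_le_of_closed (hP : IsPolymatroid P) (ha : a ∈ P) {U : Finset (Fin n)}
    (hU : ∀ i j, Exch P a i j → i ∈ U → j ∈ U) (hb : b ∈ P) :
    ∑ k ∈ U, a k ≤ ∑ k ∈ U, b k := by
  refine hP.path_induction ha (motive := fun b => ∑ k ∈ U, a k ≤ ∑ k ∈ U, b k) le_rfl
    (fun b i j h hb => hb.trans ?_) hb
  have := hU i j h
  simp only [Pi.add_apply, Pi.sub_apply, Finset.sum_add_distrib, Finset.sum_sub_distrib,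
    Finset.sum_pi_single']
  split_ifs <;> simp_all

lemma IsPolymatroid.sum_eq (hP : IsPolymatroid P) (ha : a ∈ P) (hb : b ∈ P) :
    ∑ k, a k = ∑ k, b k :=
  le_antisymm (hP.sum_le_of_closed ha (fun _ _ _ _ => Finset.mem_univ _) hb)
    (hP.sum_le_of_closed hb (fun _ _ _ _ => Finset.mem_univ _) ha)

end Exchange

/-! ### The activity weights -/

/-- The contribution of the index `i` to the summand of `a` in the Tutte polynomial: `x`, `y`,
`x + y - 1` or `1`, according to which activities `i` has. -/
noncomputable def actWt {n : ℕ} (P : Finset (Fin n → ℤ)) (a : Fin n → ℤ) (i : Fin n) :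
    MvPolynomial (Fin 2) ℤ :=
  1 + (if i ∈ intAct P a then X 0 - 1 else 0) + (if i ∈ extAct P a then X 1 - 1 else 0)

lemma tutte_eq_sum_prod {n : ℕ} (P : Finset (Fin n → ℤ)) :
    tutte P = ∑ a ∈ P, ∏ i, actWt P a i := by
  refine Finset.sum_congr rfl fun a _ => ?_
  have hprod : ∀ (S : Finset (Fin n)) (z : MvPolynomial (Fin 2) ℤ),
      z ^ S.card = ∏ i, if i ∈ S then z else 1 := fun S z => by
    rw [Finset.prod_ite_mem, Finset.univ_inter, Finset.prod_const]
  rw [hprod, hprod, hprod, ← Finset.prod_mul_distrib, ← Finset.prod_mul_distrib]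
  refine Finset.prod_congr rfl fun i _ => ?_
  by_cases h₁ : i ∈ intAct P a <;> by_cases h₂ : i ∈ extAct P a <;> simp [actWt, h₁, h₂]
  ring

/-- The weight of an element `k` of a finite set `S` of integers: it is `x` at the minimum, `y` at
the maximum, `x + y - 1` if `S = {k}`, and `1` elsewhere. -/
noncomputable def endWt (S : ℤ → Prop) (k : ℤ) : MvPolynomial (Fin 2) ℤ :=
  open Classical in
  1 + (if ∃ k' < k, S k' then 0 else X 0 - 1) + (if ∃ k' > k, S k' then 0 else X 1 - 1)

lemma tutte_empty {n : ℕ} : tutte (∅ : Finset (Fin n → ℤ)) = 0 := by simp [tutte]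

/-! ### Slices -/

/-- The slice of `P` on which the `i`-th coordinate is `k`, with that coordinate omitted. -/
def slice {n : ℕ} (P : Finset (Fin (n + 1) → ℤ)) (i : Fin (n + 1)) (k : ℤ) :
    Finset (Fin n → ℤ) :=
  project {a ∈ P | a i = k} i

section Slice

variable {n : ℕ} {P : Finset (Fin (n + 1) → ℤ)} {p : Fin (n + 1)} {k : ℤ} {c : Fin n → ℤ}

lemma mem_slice : c ∈ slice P p k ↔ p.insertNth (α := fun _ => ℤ) k c ∈ P := by
  simp only [slice, project, Finset.mem_image, Finset.mem_filter]
  constructor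
  · rintro ⟨a, ⟨ha, rfl⟩, rfl⟩
    simpa using ha
  · intro h
    exact ⟨_, ⟨h, by simp⟩, by simp⟩

lemma removeNth_mem_slice {a : Fin (n + 1) → ℤ} (ha : a ∈ P) : p.removeNth a ∈ slice P p (a p) := by
  rw [mem_slice]; simpa using ha

lemma slice_eq_empty (h : ∀ a ∈ P, a p ≠ k) : slice P p k = ∅ := by
  refine Finset.eq_empty_of_forall_notMem fun c hc => h _ (mem_slice.1 hc) (by simp)

lemma insertNth_exch (i j : Fin n) :
    p.insertNth (α := fun _ => ℤ) k (c - Pi.single i 1 + Pi.single j 1) =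
      p.insertNth (α := fun _ => ℤ) k c - Pi.single (p.succAbove i) 1
        + Pi.single (p.succAbove j) 1 := by
  ext l
  refine Fin.succAboveCases p ?_ (fun l => ?_) l
  · simp
  · simp [Pi.single_apply]

lemma exch_slice {i j : Fin n} :
    Exch (slice P p k) c i j ↔
      Exch P (p.insertNth (α := fun _ => ℤ) k c) (p.succAbove i) (p.succAbove j) := by
  rw [Exch, mem_slice, insertNth_exch, Exch]

lemma IsPolymatroid.slice (hP : IsPolymatroid P) {a : Fin (n + 1) → ℤ} (ha : a ∈ P)
    (hk : a p = k) : IsPolymatroid (slice P p k) := by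
  refine ⟨⟨_, hk ▸ removeNth_mem_slice ha⟩, fun a ha b hb i hi => ?_⟩
  obtain ⟨j, hj, h₁, h₂⟩ := hP.exchange _ (mem_slice.1 ha) _ (mem_slice.1 hb) (p.succAbove i)
    (by simpa using hi)
  rcases Fin.eq_self_or_eq_succAbove p j with rfl | ⟨j, rfl⟩
  · simp at hj
  · exact ⟨j, by simpa using hj, exch_slice.2 h₁, exch_iff'.1 (exch_slice.2 (exch_iff'.2 h₂))⟩

lemma IsPolymatroid.mem_intAct_last (hP : IsPolymatroid P) {a : Fin (n + 1) → ℤ} (ha : a ∈ P) :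
    Fin.last n ∈ intAct P a ↔ ¬ ∃ k' < a (Fin.last n), ∃ b ∈ P, b (Fin.last n) = k' := by
  rw [mem_intAct]
  constructor
  · rintro h ⟨k', hk', b, hb, rfl⟩
    obtain ⟨j, hj, h₁, -⟩ := hP.exchange a ha b hb _ hk'
    exact h j (lt_of_le_of_ne (Fin.le_last j) (by rintro rfl; omega)) h₁
  · intro h j hj hE
    exact h ⟨_, by simp [hj.ne'], _, hE, rfl⟩

lemma IsPolymatroid.mem_extAct_last (hP : IsPolymatroid P) {a : Fin (n + 1) → ℤ} (ha : a ∈ P) :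
    Fin.last n ∈ extAct P a ↔ ¬ ∃ k' > a (Fin.last n), ∃ b ∈ P, b (Fin.last n) = k' := by
  rw [mem_extAct]
  constructor
  · rintro h ⟨k', hk', b, hb, rfl⟩
    obtain ⟨j, hj, -, h₁⟩ := hP.exchange b hb a ha _ hk'
    exact h j (lt_of_le_of_ne (Fin.le_last j) (by rintro rfl; omega)) (exch_iff'.2 h₁)
  · intro h j hj hE
    exact h ⟨_, by simp [hj.ne'], _, hE, rfl⟩

/-- Only smaller indices matter for activity, so slicing at the last index keeps the activities of
the others. -/
lemma succAbove_mem_intAct {i : Fin n} :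
    (Fin.last n).succAbove i ∈ intAct P ((Fin.last n).insertNth (α := fun _ => ℤ) k c) ↔
      i ∈ intAct (slice P (Fin.last n) k) c := by
  simp only [mem_intAct, exch_slice]
  constructor
  · intro h j hj
    exact h _ ((Fin.succAbove_lt_succAbove_iff).2 hj)
  · intro h j hj
    rcases Fin.eq_self_or_eq_succAbove (Fin.last n) j with rfl | ⟨j, rfl⟩
    · exact absurd hj (Fin.le_last _).not_gt
    · exact h j ((Fin.succAbove_lt_succAbove_iff).1 hj)

lemma succAbove_mem_extAct {i : Fin n} :
    (Fin.last n).succAbove i ∈ extAct P ((Fin.last n).insertNth (α := fun _ => ℤ) k c) ↔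
      i ∈ extAct (slice P (Fin.last n) k) c := by
  simp only [mem_extAct, exch_slice]
  constructor
  · intro h j hj
    exact h _ ((Fin.succAbove_lt_succAbove_iff).2 hj)
  · intro h j hj
    rcases Fin.eq_self_or_eq_succAbove (Fin.last n) j with rfl | ⟨j, rfl⟩
    · exact absurd hj (Fin.le_last _).not_gt
    · exact h j ((Fin.succAbove_lt_succAbove_iff).1 hj)

lemma sum_eq_sum_slice {M : Type*} [AddCommMonoid M] (P : Finset (Fin (n + 1) → ℤ))
    (p : Fin (n + 1)) {K : Finset ℤ} (hK : ∀ a ∈ P, a p ∈ K) (g : (Fin (n + 1) → ℤ) → M) :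
    ∑ a ∈ P, g a =
      ∑ k ∈ K, ∑ c ∈ slice P p k, g (p.insertNth (α := fun _ => ℤ) k c) := by
  rw [← Finset.sum_fiberwise_of_maps_to hK]
  refine Finset.sum_congr rfl fun k _ => ?_
  refine Finset.sum_bij' (fun a _ => p.removeNth a)
    (fun c _ => p.insertNth (α := fun _ => ℤ) k c) ?_ ?_ ?_ ?_ ?_
  · intro a ha
    rw [Finset.mem_filter] at ha
    exact ha.2 ▸ removeNth_mem_slice ha.1
  · intro c hc
    simpa using mem_slice.1 hc
  · intro a ha
    rw [Finset.mem_filter] at ha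
    simp [← ha.2]
  · intro c _
    simp
  · intro a ha
    rw [Finset.mem_filter] at ha
    simp [← ha.2]

lemma IsPolymatroid.actWt_last (hP : IsPolymatroid P)
    (hc : c ∈ PolymatroidTutte.slice P (Fin.last n) k) :
    actWt P ((Fin.last n).insertNth (α := fun _ => ℤ) k c) (Fin.last n) =
      endWt (fun k' => ∃ b ∈ P, b (Fin.last n) = k') k := by
  have := mem_slice.1 hc
  have h₁ := hP.mem_intAct_last this
  have h₂ := hP.mem_extAct_last this
  rw [Fin.insertNth_apply_same] at h₁ h₂
  rw [actWt, endWt]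
  congr 1
  · congr 1
    by_cases h : Fin.last n ∈ intAct P ((Fin.last n).insertNth k c)
    · rw [if_pos h, if_neg (h₁.1 h)]
    · rw [if_neg h, if_pos (not_not.1 (mt h₁.2 h))]
  · by_cases h : Fin.last n ∈ extAct P ((Fin.last n).insertNth k c)
    · rw [if_pos h, if_neg (h₂.1 h)]
    · rw [if_neg h, if_pos (not_not.1 (mt h₂.2 h))]

lemma IsPolymatroid.tutte_eq_sum_slice_last (hP : IsPolymatroid P) {K : Finset ℤ}
    (hK : ∀ a ∈ P, a (Fin.last n) ∈ K) :
    tutte P = ∑ k ∈ K, endWt (fun k' => ∃ b ∈ P, b (Fin.last n) = k') k *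
      tutte (PolymatroidTutte.slice P (Fin.last n) k) := by
  rw [tutte_eq_sum_prod, sum_eq_sum_slice P (Fin.last n) hK]
  refine Finset.sum_congr rfl fun k _ => ?_
  rw [tutte_eq_sum_prod, Finset.mul_sum]
  refine Finset.sum_congr rfl fun c hc => ?_
  rw [Fin.prod_univ_succAbove _ (Fin.last n), hP.actWt_last hc]
  congr 1
  simp only [actWt, succAbove_mem_intAct, succAbove_mem_extAct]

end Slice

/-! ### Two-dimensional M♮-convex sets -/

/-- The exchange property of the projection of a polymatroid to two of its coordinates
(M♮-convexity of a subset of `ℤ²`). -/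
structure IsMNat (M : ℤ → ℤ → Prop) : Prop where
  left : ∀ {k l k' l'}, M k l → M k' l' → k' < k →
    (M (k - 1) l ∧ M (k' + 1) l') ∨ (l < l' ∧ M (k - 1) (l + 1) ∧ M (k' + 1) (l' - 1))
  right : ∀ {k l k' l'}, M k l → M k' l' → l' < l →
    (M k (l - 1) ∧ M k' (l' + 1)) ∨ (k < k' ∧ M (k + 1) (l - 1) ∧ M (k' - 1) (l' + 1))

namespace IsMNat

variable {M : ℤ → ℤ → Prop} {k l k' l' : ℤ}

lemma swap (hM : IsMNat M) : IsMNat fun l k => M k l where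
  left h h' hk := hM.right h h' hk
  right h h' hk := hM.left h h' hk

lemma neg (hM : IsMNat M) : IsMNat fun k l => M (-k) (-l) where
  left {k l k' l'} h h' hk := by
    have := hM.left h' h (by omega : -k < -k')
    ring_nf at this ⊢
    rcases this with h | h
    · exact .inl ⟨h.2, h.1⟩
    · exact .inr ⟨by omega, h.2.2, h.2.1⟩
  right {k l k' l'} h h' hk := by
    have := hM.right h' h (by omega : -l < -l')
    ring_nf at this ⊢
    rcases this with h | h
    · exact .inl ⟨h.2, h.1⟩
    · exact .inr ⟨by omega, h.2.2, h.2.1⟩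

lemma row (hM : IsMNat M) (h : M k l) (h' : M k l') (hl : l' < l) : M k (l - 1) := by
  rcases hM.right h h' hl with h | h
  · exact h.1
  · omega

/-- A point from which neither coordinate can be decreased has the minimal coordinate sum. -/
lemma add_le_add (hM : IsMNat M) (h : M k l) (h₁ : ¬ M k (l - 1)) (h₂ : ¬ M (k - 1) l)
    (h' : M k' l') : k + l ≤ k' + l' := by
  induction hN : (k' - k).natAbs + (l' - l).natAbs using Nat.strong_induction_on
    generalizing k' l' with
  | _ N ih =>
    by_contra! hlt
    by_cases hk : k' < k
    · rcases hM.left h h' hk with h₃ | ⟨hl, -, h₃⟩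
      · exact h₂ h₃.1
      · have := ih _ (by omega) h₃ rfl
        omega
    by_cases hl : l' < l
    · rcases hM.right h h' hl with h₃ | ⟨hl, -, h₃⟩
      · exact h₁ h₃.1
      · have := ih _ (by omega) h₃ rfl
        omega
    omega

/-- If the first coordinate can be decreased at a point and the second one cannot, then the second
one is minimal. -/
lemma le_of_left (hM : IsMNat M) (h : M k l) (h₁ : ¬ M k (l - 1)) (h₂ : M (k - 1) l)
    (h' : M k' l') : l ≤ l' := by
  by_contra! hl
  rcases hM.right h h' hl with h₃ | ⟨-, h₃, -⟩
  · exact h₁ h₃.1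
  · rcases hM.left h₃ h₂ (by omega) with h₄ | ⟨-, -, h₄⟩
    · exact h₁ (by simpa using h₄.1)
    · exact h₁ (by simpa using h₄)

/-- If the first coordinate is minimal at a point where the second one cannot be increased, then the
second one is maximal. -/
lemma ge_of_min (hM : IsMNat M) (h : M k l) (h₁ : ¬ M k (l + 1))
    (h₂ : ∀ k' l', M k' l' → k ≤ k') (h' : M k' l') : l' ≤ l := by
  by_contra! hl
  rcases hM.right h' h hl with h₃ | ⟨h₃, -⟩
  · exact h₁ h₃.2
  · have := h₂ _ _ h'
    omega

/-- The vertex with minimal first coordinate and, subject to this, minimal second coordinate. It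
lies on the edge of minimal coordinate sum. -/
lemma exists_corner (hM : IsMNat M) (hfin : {v : ℤ × ℤ | M v.1 v.2}.Finite)
    (hne : ∃ k l, M k l) :
    ∃ k₀ l₀, M k₀ l₀ ∧ (∀ k l, M k l → k₀ + l₀ ≤ k + l) ∧
      ∀ k l, M k l → ((¬ (∃ k' < k, ∃ l', M k' l') ∧ ¬ ∃ l' < l, M k l') ↔ k = k₀ ∧ l = l₀) := by
  obtain ⟨k, l, h⟩ := hne
  obtain ⟨⟨k₀, l₀⟩, h₀, hmin⟩ := Set.exists_min_image _ (fun v : ℤ × ℤ => toLex v) hfin ⟨(k, l), h⟩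
  have hmin' : ∀ k l, M k l → k₀ < k ∨ k₀ = k ∧ l₀ ≤ l := fun k l h => by
    simpa [Prod.Lex.toLex_le_toLex] using hmin (k, l) h
  refine ⟨k₀, l₀, h₀, fun k l h => ?_, fun k l h => ⟨?_, ?_⟩⟩
  · refine hM.add_le_add h₀ (fun h => ?_) (fun h => ?_) h
    · have := hmin' _ _ h; omega
    · have := hmin' _ _ h; omega
  · rintro ⟨h₁, h₂⟩
    have h₃ : k = k₀ := by
      by_contra hk
      have := hmin' _ _ h
      exact h₁ ⟨k₀, by omega, l₀, h₀⟩
    subst h₃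
    refine ⟨rfl, ?_⟩
    by_contra hk
    have := hmin' _ _ h
    exact h₂ ⟨l₀, by omega, h₀⟩
  · rintro ⟨rfl, rfl⟩
    refine ⟨?_, ?_⟩
    · rintro ⟨k', hk, l', h'⟩
      have := hmin' _ _ h'; omega
    · rintro ⟨l', hl, h'⟩
      have := hmin' _ _ h'; omega

lemma exists_corner_max (hM : IsMNat M) (hfin : {v : ℤ × ℤ | M v.1 v.2}.Finite)
    (hne : ∃ k l, M k l) :
    ∃ k₀ l₀, M k₀ l₀ ∧ (∀ k l, M k l → k + l ≤ k₀ + l₀) ∧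
      ∀ k l, M k l → ((¬ (∃ k' > k, ∃ l', M k' l') ∧ ¬ ∃ l' > l, M k l') ↔ k = k₀ ∧ l = l₀) := by
  obtain ⟨k, l, h⟩ := hne
  obtain ⟨k₀, l₀, h₀, h₁, h₂⟩ := hM.neg.exists_corner
    ((hfin.preimage (neg_injective (G := ℤ × ℤ)).injOn : _)) ⟨-k, -l, by simpa using h⟩
  refine ⟨-k₀, -l₀, h₀, fun k l h => ?_, fun k l h => ?_⟩
  · have := h₁ (-k) (-l) (by simpa using h)
    omega
  · have := h₂ (-k) (-l) (by simpa using h)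
    rw [neg_eq_iff_eq_neg, neg_eq_iff_eq_neg] at this
    rw [← this]
    refine and_congr (not_congr ⟨?_, ?_⟩) (not_congr ⟨?_, ?_⟩)
    · rintro ⟨k', hk, l', h'⟩
      exact ⟨-k', by omega, -l', by simpa using h'⟩
    · rintro ⟨k', hk, l', h'⟩
      exact ⟨-k', by omega, -l', by simpa using h'⟩
    · rintro ⟨l', hl, h'⟩
      exact ⟨-l', by omega, by simpa using h'⟩
    · rintro ⟨l', hl, h'⟩
      exact ⟨-l', by omega, by simpa using h'⟩

lemma ind_linear {R : Type*} [CommRing R] (p q p' q' : Prop)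
    [Decidable p] [Decidable q] [Decidable p'] [Decidable q']
    (g₁ : p' → p) (g₂ : q → q') (g₃ : ¬ q → p' → ¬ q') (g₄ : ¬ p' → q → ¬ p) :
    (if p then 0 else 1 : R) + (if q then 0 else 1) - (if q' then 0 else 1)
        - (if p' then 0 else 1) =
      (if p then 0 else 1) * (if q then 0 else 1)
        - (if q' then 0 else 1) * (if p' then 0 else 1) := by
  by_cases hp : p
  · by_cases hq : q
    · have h' : p' := by by_contra h; exact g₄ h hq hp
      simp [hp, hq, g₂ hq, h']
    · by_cases h' : p'
      · simp [hp, hq, g₃ hq h', h']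
      · by_cases h'' : q' <;> simp [hp, hq, h', h'']
  · have h' : ¬ p' := fun h => hp (g₁ h)
    by_cases hq : q
    · simp [hp, hq, h', g₂ hq]
    · by_cases h'' : q' <;> simp [hp, hq, h', h'']

lemma ind_mixed {R : Type*} [CommRing R] (p q p' q' : Prop)
    [Decidable p] [Decidable q] [Decidable p'] [Decidable q']
    (g₁ : p' → p) (g₂ : q → q') (g₃ : ¬ p → ¬ q → ¬ q') (g₄ : ¬ q' → ¬ p' → ¬ p) :
    (if p then 0 else 1 : R) * (if q then 0 else 1) =
      (if q' then 0 else 1) * (if p' then 0 else 1) := by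
  have h : (¬ p ∧ ¬ q) ↔ (¬ q' ∧ ¬ p') :=
    ⟨fun h => ⟨g₃ h.1 h.2, fun h' => h.1 (g₁ h')⟩, fun h => ⟨g₄ h.1 h.2, fun h' => h.1 (g₂ h')⟩⟩
  have two : ∀ (p q : Prop) [Decidable p] [Decidable q],
      (if p then 0 else 1 : R) * (if q then 0 else 1) = if ¬ p ∧ ¬ q then 1 else 0 := by
    intro p q _ _
    split_ifs <;> simp_all
  rw [two, two]
  exact if_congr h rfl rfl

/-- The difference of the two weightings at one point of a two-dimensional M♮-convex set. Here `A`,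
`B` (`C`, `D`) say that the first (second) coordinate of the point is not minimal, not maximal;
`a`, `b` (`c`, `d`) say that it is not so among the points with the same second (first) coordinate.
The hypotheses are the relations between these properties that hold by M♮-convexity. -/
lemma wt_identity {R : Type*} [CommRing R] (x y : R) (A B C D a b c d : Prop)
    [Decidable A] [Decidable B] [Decidable C] [Decidable D]
    [Decidable a] [Decidable b] [Decidable c] [Decidable d]
    (aA : a → A) (bB : b → B) (cC : c → C) (dD : d → D)
    (h₁ : ¬ c → a → ¬ C) (h₂ : ¬ a → c → ¬ A) (h₃ : ¬ d → b → ¬ D) (h₄ : ¬ b → d → ¬ B)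
    (h₅ : ¬ A → ¬ d → ¬ D) (h₆ : ¬ B → ¬ c → ¬ C) (h₇ : ¬ C → ¬ b → ¬ B)
    (h₈ : ¬ D → ¬ a → ¬ A) :
    (1 + (if A then 0 else x - 1) + (if B then 0 else y - 1)) *
        (1 + (if c then 0 else x - 1) + (if d then 0 else y - 1)) +
      ((if ¬ C ∧ ¬ a then x * (x - 1) else 0) + (if ¬ D ∧ ¬ b then y * (y - 1) else 0)) =
    (1 + (if C then 0 else x - 1) + (if D then 0 else y - 1)) *
        (1 + (if a then 0 else x - 1) + (if b then 0 else y - 1)) +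
      ((if ¬ A ∧ ¬ c then x * (x - 1) else 0) + (if ¬ B ∧ ¬ d then y * (y - 1) else 0)) := by
  have one : ∀ (p : Prop) [Decidable p] (z : R),
      (if p then 0 else z) = z * (if p then 0 else 1) := fun p _ z => by split_ifs <;> simp
  have two : ∀ (p q : Prop) [Decidable p] [Decidable q] (z : R),
      (if ¬ p ∧ ¬ q then z else 0) = z * ((if p then 0 else 1) * (if q then 0 else 1)) :=
    fun p q _ _ z => by by_cases p <;> by_cases q <;> simp_all
  have i₁ := ind_linear (R := R) A c a C aA cC h₁ h₂
  have i₂ := ind_linear (R := R) B d b D bB dD h₃ h₄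
  have i₃ := ind_mixed (R := R) A d a D aA dD h₅ h₈
  have i₄ := ind_mixed (R := R) B c b C bB cC h₆ h₇
  simp only [one _ (x - 1), one _ (y - 1), two]
  linear_combination (x - 1) * i₁ + (y - 1) * i₂ + (x - 1) * (y - 1) * (i₃ + i₄)

/-- In a two-dimensional M♮-convex set, weighting the ends of the projection and then the ends of
the fibres gives the same result for both projections, for any function that is constant on the
edges of minimal and of maximal coordinate sum. The two weightings differ in the corners only. -/
lemma sum_endWt (hM : IsMNat M) (s : Finset (ℤ × ℤ)) (hs : ∀ k l, (k, l) ∈ s ↔ M k l)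
    (F : ℤ → ℤ → MvPolynomial (Fin 2) ℤ)
    (hmin : ∀ {k l k' l'}, M k l → M k' l' → k + l = k' + l' →
      (∀ i j, M i j → k + l ≤ i + j) → F k l = F k' l')
    (hmax : ∀ {k l k' l'}, M k l → M k' l' → k + l = k' + l' →
      (∀ i j, M i j → i + j ≤ k + l) → F k l = F k' l') :
    ∑ v ∈ s, endWt (fun k => ∃ l, M k l) v.1 * endWt (M v.1) v.2 * F v.1 v.2 =
      ∑ v ∈ s, endWt (fun l => ∃ k, M k l) v.2 * endWt (fun k => M k v.2) v.1 * F v.1 v.2 := by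
  classical
  rcases s.eq_empty_or_nonempty with rfl | ⟨v, hv⟩
  · simp
  have hne : ∃ k l, M k l := ⟨v.1, v.2, (hs _ _).1 hv⟩
  have hne' : ∃ l k, M k l := ⟨v.2, v.1, (hs _ _).1 hv⟩
  have hfin : {v : ℤ × ℤ | M v.1 v.2}.Finite :=
    s.finite_toSet.subset fun v hv => (hs v.1 v.2).2 hv
  have hfin' : {v : ℤ × ℤ | M v.2 v.1}.Finite := hfin.preimage Prod.swap_injective.injOn
  have single : ∀ (p : ℤ → ℤ → Prop) [∀ k l, Decidable (p k l)] (z : MvPolynomial (Fin 2) ℤ)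
      (k₀ l₀ : ℤ), M k₀ l₀ →
      (∀ k l, M k l → (p k l ↔ k = k₀ ∧ l = l₀)) →
      ∑ v ∈ s, (if p v.1 v.2 then z else 0) * F v.1 v.2 = z * F k₀ l₀ := by
    intro p _ z k₀ l₀ h₀ hp
    rw [Finset.sum_eq_single (k₀, l₀)]
    · rw [if_pos ((hp _ _ h₀).2 ⟨rfl, rfl⟩)]
    · rintro ⟨k, l⟩ hv hne
      rw [if_neg (fun h => hne ?_), zero_mul]
      obtain ⟨rfl, rfl⟩ := (hp _ _ ((hs _ _).1 hv)).1 h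
      rfl
    · exact fun h => absurd ((hs _ _).2 h₀) h
  obtain ⟨k₁, l₁, m₁, s₁, u₁⟩ := hM.exists_corner hfin hne
  obtain ⟨l₂, k₂, m₂, s₂, u₂⟩ := hM.swap.exists_corner hfin' hne'
  obtain ⟨k₃, l₃, m₃, s₃, u₃⟩ := hM.exists_corner_max hfin hne
  obtain ⟨l₄, k₄, m₄, s₄, u₄⟩ := hM.swap.exists_corner_max hfin' hne'
  have e₁ : F k₁ l₁ = F k₂ l₂ := hmin m₁ m₂
    (by have := s₁ _ _ m₂; have := s₂ _ _ m₁; omega) s₁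
  have e₂ : F k₃ l₃ = F k₄ l₄ := hmax m₃ m₄
    (by have := s₃ _ _ m₄; have := s₄ _ _ m₃; omega) s₃
  have hsum := Finset.sum_congr (rfl : s = s) fun v hv => by
    have hv := (hs v.1 v.2).1 hv
    have hN := hM.neg
    have hv' : M (- -v.1) (- -v.2) := by simpa using hv
    refine congrArg (· * F v.1 v.2) (wt_identity (X 0 : MvPolynomial (Fin 2) ℤ) (X 1)
      (∃ k' < v.1, ∃ l', M k' l') (∃ k' > v.1, ∃ l', M k' l')
      (∃ l' < v.2, ∃ k', M k' l') (∃ l' > v.2, ∃ k', M k' l')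
      (∃ k' < v.1, M k' v.2) (∃ k' > v.1, M k' v.2) (∃ l' < v.2, M v.1 l') (∃ l' > v.2, M v.1 l')
      ?_ ?_ ?_ ?_ ?_ ?_ ?_ ?_ ?_ ?_ ?_ ?_)
    · rintro ⟨k, hk, h⟩; exact ⟨k, hk, _, h⟩
    · rintro ⟨k, hk, h⟩; exact ⟨k, hk, _, h⟩
    · rintro ⟨k, hk, h⟩; exact ⟨k, hk, _, h⟩
    · rintro ⟨k, hk, h⟩; exact ⟨k, hk, _, h⟩
    · rintro h₁ ⟨k, hk, h⟩ ⟨l', hl, k', h'⟩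
      have := hM.le_of_left hv (fun h => h₁ ⟨_, by omega, h⟩) (hM.swap.row hv h hk) h'
      omega
    · rintro h₁ ⟨k, hk, h⟩ ⟨l', hl, k', h'⟩
      have := hM.swap.le_of_left hv (fun h => h₁ ⟨_, by omega, h⟩) (hM.row hv h hk) h'
      omega
    · rintro h₁ ⟨k, hk, h⟩ ⟨l', hl, k', h'⟩
      have := hN.le_of_left (k' := -k') (l' := -l') hv'
        (fun h => h₁ ⟨v.2 + 1, by omega, by convert h using 1 <;> ring⟩)
        (hN.swap.row hv' (l' := -k) (by simpa using h) (by omega)) (by simpa using h')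
      omega
    · rintro h₁ ⟨k, hk, h⟩ ⟨l', hl, k', h'⟩
      have := hN.swap.le_of_left (k' := -k') (l' := -l') hv'
        (fun h => h₁ ⟨v.1 + 1, by omega, by convert h using 1 <;> ring⟩)
        (hN.row hv' (l' := -k) (by simpa using h) (by omega)) (by simpa using h')
      omega
    · rintro h₁ h₂ ⟨l', hl, k', h'⟩
      have := hM.ge_of_min hv (fun h => h₂ ⟨_, by omega, h⟩)
        (fun k l h => by by_contra! hk; exact h₁ ⟨_, hk, _, h⟩) h'
      omega
    · rintro h₁ h₂ ⟨l', hl, k', h'⟩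
      have := hN.ge_of_min (k' := -k') (l' := -l') hv'
        (fun h => h₂ ⟨v.2 - 1, by omega, by convert h using 1 <;> ring⟩)
        (fun k l h => by by_contra! hk; exact h₁ ⟨_, by omega, _, h⟩) (by simpa using h')
      omega
    · rintro h₁ h₂ ⟨l', hl, k', h'⟩
      have := hM.swap.ge_of_min hv (fun h => h₂ ⟨_, by omega, h⟩)
        (fun k l h => by by_contra! hk; exact h₁ ⟨_, hk, _, h⟩) h'
      omega
    · rintro h₁ h₂ ⟨l', hl, k', h'⟩
      have := hN.swap.ge_of_min (k' := -k') (l' := -l') hv'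
        (fun h => h₂ ⟨v.1 - 1, by omega, by convert h using 1 <;> ring⟩)
        (fun k l h => by by_contra! hk; exact h₁ ⟨_, by omega, _, h⟩) (by simpa using h')
      omega
  simp only [add_mul _ _ (F _ _), Finset.sum_add_distrib] at hsum
  rw [single (fun k l => _) _ _ _ m₁ u₁, single (fun k l => _) _ _ _ m₃ u₃,
    single (fun k l => _) _ _ _ m₂ (fun k l h => (u₂ l k h).trans and_comm),
    single (fun k l => _) _ _ _ m₄ (fun k l h => (u₄ l k h).trans and_comm), e₁, e₂] at hsum
  exact add_right_cancel hsum

end IsMNat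

/-! ### Slicing at an arbitrary index -/

section TwoCoordinates

variable {n : ℕ} {P : Finset (Fin n → ℤ)} {p q : Fin n}

/-- The projection of `P` to the coordinates `p` and `q`. -/
def shadow (P : Finset (Fin n → ℤ)) (p q : Fin n) (k l : ℤ) : Prop := ∃ a ∈ P, a p = k ∧ a q = l

lemma IsPolymatroid.shadow_left (hP : IsPolymatroid P) (hpq : p ≠ q) {k l k' l' : ℤ}
    (h : shadow P p q k l) (h' : shadow P p q k' l') (hk : k' < k) :
    (shadow P p q (k - 1) l ∧ shadow P p q (k' + 1) l') ∨
      (l < l' ∧ shadow P p q (k - 1) (l + 1) ∧ shadow P p q (k' + 1) (l' - 1)) := by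
  obtain ⟨a, ha, rfl, rfl⟩ := h
  obtain ⟨b, hb, rfl, rfl⟩ := h'
  obtain ⟨j, hj, h₁, h₂⟩ := hP.exchange a ha b hb p hk
  have hjp : j ≠ p := by rintro rfl; omega
  by_cases hjq : j = q
  · subst hjq
    exact .inr ⟨hj, ⟨_, h₁, by simp [hpq], by simp [hjp]⟩,
      ⟨_, h₂, by simp [hpq], by simp [hjp]⟩⟩
  · exact .inl ⟨⟨_, h₁, by simp [hjp.symm], by simp [hpq.symm, Ne.symm hjq]⟩,
      ⟨_, h₂, by simp [hjp.symm], by simp [hpq.symm, Ne.symm hjq]⟩⟩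

lemma shadow_comm {k l : ℤ} : shadow P p q k l ↔ shadow P q p l k := by
  simp only [shadow, and_comm]

lemma IsPolymatroid.isMNat_shadow (hP : IsPolymatroid P) (hpq : p ≠ q) :
    IsMNat (shadow P p q) where
  left h h' hk := hP.shadow_left hpq h h' hk
  right h h' hk := by
    simp only [shadow_comm (p := p)] at h h' ⊢
    exact hP.shadow_left hpq.symm h h' hk

/-- On a face on which `a p + a q` is extremal, the coordinates `p` and `q` can be varied
independently of the others: such a face is a direct sum. -/
lemma IsPolymatroid.add_mem_of_extremal (hP : IsPolymatroid P) (hpq : p ≠ q)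
    {a b : Fin n → ℤ} (ha : a ∈ P) (hb : b ∈ P) (hab : a p + a q = b p + b q)
    (hext : (∀ c ∈ P, b p + b q ≤ c p + c q) ∨ (∀ c ∈ P, c p + c q ≤ b p + b q)) :
    a + Pi.single p (b p - a p) + Pi.single q (b q - a q) ∈ P := by
  wlog hle : a p ≤ b p generalizing p q
  · have := this hpq.symm (by omega) (by simpa only [add_comm] using hext) (by omega)
    rwa [add_right_comm] at this
  induction hN : (b p - a p).toNat generalizing a with
  | zero =>
    rw [show b p - a p = 0 by omega, show b q - a q = 0 by omega]
    simpa using ha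
  | succ N ih =>
    obtain ⟨j, hj, h₁, h₂⟩ := hP.exchange b hb a ha p (by omega)
    have hjp : j ≠ p := by rintro rfl; omega
    have hjq : j = q := by
      by_contra hjq
      rcases hext with hext | hext
      · have := hext _ h₁
        simp [hjp.symm, hpq.symm, Ne.symm hjq] at this
      · have := hext _ h₂
        simp [hjp.symm, hpq.symm, Ne.symm hjq] at this
        omega
    subst hjq
    have := ih h₂ (by simp [hpq, hjp]; omega) (by simp [hjp.symm]; omega)
      (by simp [hjp.symm]; omega)
    convert this using 1
    ext i
    by_cases hip : i = p
    · subst hip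
      simp [hjp.symm]
    · by_cases hij : i = j
      · subst hij
        simp [hjp]
      · simp [hip, hij]

end TwoCoordinates

variable {n : ℕ}

lemma insertNth_insertNth (p : Fin (n + 2)) (q : Fin (n + 1)) (k l : ℤ) (c : Fin n → ℤ) :
    p.insertNth (α := fun _ => ℤ) k (q.insertNth (α := fun _ => ℤ) l c) =
      (p.succAbove q).insertNth (α := fun _ => ℤ) l
        ((q.predAbove p).insertNth (α := fun _ => ℤ) k c) := by
  refine Fin.eq_insertNth_iff.2 ⟨by simp, Fin.eq_insertNth_iff.2 ⟨?_, ?_⟩⟩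
  · simp [Fin.removeNth, Fin.succAbove_succAbove_predAbove]
  · rw [← Fin.removeNth_removeNth_eq_swap]
    simp

lemma slice_slice_comm (P : Finset (Fin (n + 2) → ℤ)) (p : Fin (n + 2)) (q : Fin (n + 1))
    (k l : ℤ) :
    slice (slice P p k) q l = slice (slice P (p.succAbove q) l) (q.predAbove p) k := by
  ext c
  rw [mem_slice, mem_slice, mem_slice, mem_slice, insertNth_insertNth]

lemma slice_slice_subset {P : Finset (Fin (n + 2) → ℤ)} (hP : IsPolymatroid P)
    (p : Fin (n + 2)) (q : Fin (n + 1)) {k l k' l' : ℤ} (h' : shadow P p (p.succAbove q) k' l')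
    (hkl : k + l = k' + l')
    (hext : (∀ i j, shadow P p (p.succAbove q) i j → k + l ≤ i + j) ∨
      (∀ i j, shadow P p (p.succAbove q) i j → i + j ≤ k + l)) :
    slice (slice P p k) q l ⊆ slice (slice P p k') q l' := by
  intro c hc
  obtain ⟨b, hb, rfl, rfl⟩ := h'
  simp only [mem_slice] at hc ⊢
  have hpq : p ≠ p.succAbove q := (Fin.succAbove_ne p q).symm
  have := hP.add_mem_of_extremal hpq hc hb (by simpa using hkl)
    (hext.imp (fun h c hc => hkl ▸ h _ _ ⟨c, hc, rfl, rfl⟩)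
      (fun h c hc => hkl ▸ h _ _ ⟨c, hc, rfl, rfl⟩))
  convert this using 1
  ext i
  refine Fin.succAboveCases p ?_ (fun i => ?_) i
  · simp
  · refine Fin.succAboveCases q ?_ (fun i => ?_) i
    · simp
    · simp

/-- The sum of the weighted double slices does not depend on which of the two coordinates is sliced
first. -/
lemma sum_slice_slice {P : Finset (Fin (n + 2) → ℤ)} (hP : IsPolymatroid P)
    (p : Fin (n + 2)) (q : Fin (n + 1)) {K L : Finset ℤ} (hK : ∀ a ∈ P, a p ∈ K)
    (hL : ∀ a ∈ P, a (p.succAbove q) ∈ L) :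
    ∑ k ∈ K, endWt (fun k' => ∃ b ∈ P, b p = k') k *
        ∑ l ∈ L, endWt (fun l' => ∃ b ∈ slice P p k, b q = l') l *
          tutte (slice (slice P p k) q l) =
      ∑ l ∈ L, endWt (fun l' => ∃ b ∈ P, b (p.succAbove q) = l') l *
        ∑ k ∈ K, endWt (fun k' => ∃ b ∈ slice P (p.succAbove q) l, b (q.predAbove p) = k') k *
          tutte (slice (slice P p k) q l) := by
  classical
  have hpq : p ≠ p.succAbove q := (Fin.succAbove_ne p q).symm
  let s := P.image fun a => (a p, a (p.succAbove q))
  have hs : ∀ k l, (k, l) ∈ s ↔ shadow P p (p.succAbove q) k l := by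
    intro k l
    simp [s, shadow]
  have key := (hP.isMNat_shadow hpq).sum_endWt s hs
    (fun k l => tutte (slice (slice P p k) q l))
    (fun h h' hkl hext => congrArg tutte
      ((slice_slice_subset hP p q h' hkl (.inl hext)).antisymm
        (slice_slice_subset hP p q h hkl.symm (.inl (hkl ▸ hext)))))
    (fun h h' hkl hext => congrArg tutte
      ((slice_slice_subset hP p q h' hkl (.inr hext)).antisymm
        (slice_slice_subset hP p q h hkl.symm (.inr (hkl ▸ hext)))))
  have hsub : s ⊆ K ×ˢ L := by
    intro v hv
    obtain ⟨a, ha, rfl⟩ := Finset.mem_image.1 hv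
    exact Finset.mk_mem_product (hK a ha) (hL a ha)
  have hzero : ∀ v ∈ K ×ˢ L, v ∉ s → tutte (slice (slice P p v.1) q v.2) = 0 := by
    intro v _ hv
    rw [slice_eq_empty (P := slice P p v.1), tutte_empty]
    intro a ha hav
    exact hv ((hs _ _).2 ⟨_, mem_slice.1 ha, by simp, by simpa using hav⟩)
  rw [Finset.sum_subset hsub (fun v h₁ h₂ => by rw [hzero v h₁ h₂, mul_zero]),
    Finset.sum_subset hsub (fun v h₁ h₂ => by rw [hzero v h₁ h₂, mul_zero]),
    Finset.sum_product, Finset.sum_product_right] at key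
  have e₁ : (fun k => ∃ l, shadow P p (p.succAbove q) k l) = fun k' => ∃ b ∈ P, b p = k' := by
    funext k
    exact propext ⟨fun ⟨l, a, ha, h, _⟩ => ⟨a, ha, h⟩, fun ⟨a, ha, h⟩ => ⟨_, a, ha, h, rfl⟩⟩
  have e₂ : (fun l => ∃ k, shadow P p (p.succAbove q) k l) =
      fun l' => ∃ b ∈ P, b (p.succAbove q) = l' := by
    funext k
    exact propext ⟨fun ⟨l, a, ha, _, h⟩ => ⟨a, ha, h⟩, fun ⟨a, ha, h⟩ => ⟨_, a, ha, rfl, h⟩⟩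
  have e₃ : ∀ k, shadow P p (p.succAbove q) k = fun l' => ∃ b ∈ slice P p k, b q = l' := by
    intro k
    funext l
    refine propext ⟨?_, ?_⟩
    · rintro ⟨a, ha, rfl, rfl⟩
      exact ⟨_, removeNth_mem_slice ha, rfl⟩
    · rintro ⟨b, hb, rfl⟩
      exact ⟨_, mem_slice.1 hb, by simp, by simp⟩
  have e₄ : ∀ l, (fun k => shadow P p (p.succAbove q) k l) =
      fun k' => ∃ b ∈ slice P (p.succAbove q) l, b (q.predAbove p) = k' := by
    intro l
    funext k
    refine propext ⟨?_, ?_⟩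
    · rintro ⟨a, ha, rfl, rfl⟩
      exact ⟨_, removeNth_mem_slice ha, by simp [Fin.removeNth, Fin.succAbove_succAbove_predAbove]⟩
    · rintro ⟨b, hb, rfl⟩
      refine ⟨_, mem_slice.1 hb, ?_, by simp⟩
      have h := Fin.insertNth_apply_succAbove (α := fun _ => ℤ) (p.succAbove q) l b (q.predAbove p)
      rwa [Fin.succAbove_succAbove_predAbove] at h
  simp only [Finset.mul_sum, ← mul_assoc]
  rw [e₁, e₂] at key
  refine (Finset.sum_congr rfl fun k _ => Finset.sum_congr rfl fun l _ => ?_).trans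
    (key.trans (Finset.sum_congr rfl fun l _ => Finset.sum_congr rfl fun k _ => ?_))
  · rw [e₃]
  · rw [e₄]

/-- The recursion for the Tutte polynomial at an arbitrary index. For the last index it can be read
off from the definition; two indices may be sliced in either order, so it follows for the others by
induction. -/
theorem IsPolymatroid.tutte_eq_sum_slice {P : Finset (Fin (n + 1) → ℤ)} (hP : IsPolymatroid P)
    (i : Fin (n + 1)) {K : Finset ℤ} (hK : ∀ a ∈ P, a i ∈ K) :
    tutte P = ∑ k ∈ K, endWt (fun k' => ∃ b ∈ P, b i = k') k *
      tutte (PolymatroidTutte.slice P i k) := by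
  induction n generalizing K with
  | zero =>
    obtain rfl : i = Fin.last 0 := Subsingleton.elim (α := Fin 1) _ _
    exact hP.tutte_eq_sum_slice_last hK
  | succ n ih =>
    by_cases hi : i = Fin.last _
    · subst hi
      exact hP.tutte_eq_sum_slice_last hK
    obtain ⟨q, rfl⟩ := Fin.exists_succAbove_eq hi
    set p := Fin.last (n + 1)
    have hL : ∀ a ∈ P, a p ∈ P.image (· p) := fun a ha => Finset.mem_image_of_mem _ ha
    have expand : ∀ (r : Fin (n + 2)) (j : Fin (n + 1)) (S : ℤ → MvPolynomial (Fin 2) ℤ) (k : ℤ)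
        {L : Finset ℤ}, (∀ a ∈ P, a (r.succAbove j) ∈ L) →
        S k * tutte (PolymatroidTutte.slice P r k) =
          S k * ∑ l ∈ L, endWt (fun l' => ∃ b ∈ PolymatroidTutte.slice P r k, b j = l') l *
            tutte (PolymatroidTutte.slice (PolymatroidTutte.slice P r k) j l) := by
      intro r j S k L hL
      by_cases h : ∃ a ∈ P, a r = k
      · obtain ⟨a, ha, hk⟩ := h
        rw [← ih (hP.slice ha hk) j]
        intro c hc
        simpa using hL _ (mem_slice.1 hc)
      · push Not at h
        rw [slice_eq_empty h]
        simp [slice_eq_empty, tutte_empty]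
    rw [hP.tutte_eq_sum_slice_last hL]
    rw [Finset.sum_congr rfl fun k _ => expand p q _ k hK, sum_slice_slice hP p q hL hK]
    refine Finset.sum_congr rfl fun l _ => ?_
    rw [expand (p.succAbove q) (q.predAbove p) _ l (L := P.image (· p))
      (fun a ha => by rw [Fin.succAbove_succAbove_predAbove]; exact hL a ha)]
    simp only [slice_slice_comm P p q]

/-! ### Lattice points of the polytope -/

section Polytope

variable {n : ℕ} {P : Finset (Fin n → ℤ)} {a b c : Fin n → ℤ}

lemma toReal_zero : toReal (0 : Fin n → ℤ) = 0 := by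
  ext; simp [toReal]

lemma toReal_add_single (i : Fin n) : toReal (a + Pi.single i 1) = toReal a + Pi.single i 1 := by
  ext k
  by_cases h : k = i <;> simp [toReal, h]

lemma toReal_sub_single (i : Fin n) : toReal (a - Pi.single i 1) = toReal a - Pi.single i 1 := by
  ext k
  by_cases h : k = i <;> simp [toReal, h]

lemma toReal_mem_polytope (ha : a ∈ P) : toReal a ∈ polytope P :=
  subset_convexHull _ _ ⟨a, ha, rfl⟩

lemma convex_polytope : Convex ℝ (polytope P) := convex_convexHull _ _

lemma isLinearMap_sum (U : Finset (Fin n)) :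
    IsLinearMap ℝ fun x : Fin n → ℝ => ∑ k ∈ U, x k :=
  ⟨fun x y => by simp [Finset.sum_add_distrib], fun t x => by simp [Finset.mul_sum]⟩

lemma le_sum_of_mem_polytope {U : Finset (Fin n)} {r : ℤ} (h : ∀ b ∈ P, r ≤ ∑ k ∈ U, b k)
    {x : Fin n → ℝ} (hx : x ∈ polytope P) : (r : ℝ) ≤ ∑ k ∈ U, x k := by
  refine convexHull_min ?_ (convex_halfSpace_ge (isLinearMap_sum U) (r : ℝ)) hx
  rintro _ ⟨b, hb, rfl⟩
  simp only [toReal, Set.mem_ofPred_eq]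
  exact_mod_cast h b hb

lemma sum_le_of_mem_polytope {U : Finset (Fin n)} {r : ℤ} (h : ∀ b ∈ P, ∑ k ∈ U, b k ≤ r)
    {x : Fin n → ℝ} (hx : x ∈ polytope P) : ∑ k ∈ U, x k ≤ (r : ℝ) := by
  refine convexHull_min ?_ (convex_halfSpace_le (isLinearMap_sum U) (r : ℝ)) hx
  rintro _ ⟨b, hb, rfl⟩
  simp only [toReal, Set.mem_ofPred_eq]
  exact_mod_cast h b hb

/-- A polymatroid contains all the lattice points of its convex hull. If `c ∉ P` is a lattice point
and `a ∈ P` is nearest to it, then no arrow at `a` leads from an index with `a i > c i` to one with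
`a i < c i`, and the sum over the arrow closure of the former indices separates `c` from `P`. -/
lemma IsPolymatroid.toReal_mem_polytope_iff (hP : IsPolymatroid P) :
    toReal c ∈ polytope P ↔ c ∈ P := by
  classical
  refine ⟨fun hc => ?_, toReal_mem_polytope⟩
  obtain ⟨a, ha, hmin⟩ := P.exists_min_image (fun a => ∑ k, (a k - c k).natAbs) hP.nonempty
  have hsum : ∀ U : Finset (Fin n), (∀ i j, Exch P a i j → i ∈ U → j ∈ U) →
      ∑ k ∈ U, a k ≤ ∑ k ∈ U, c k := by
    intro U hU
    have := le_sum_of_mem_polytope (fun b hb => hP.sum_le_of_closed ha hU hb) hc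
    simp only [toReal] at this
    exact_mod_cast this
  have hno : ∀ i j, c i < a i → a j < c j → ¬ Exch P a i j := by
    intro i j hi hj h
    refine (hmin _ h).not_gt ?_
    have hij : i ≠ j := by rintro rfl; omega
    refine Finset.sum_lt_sum (fun k _ => ?_) ⟨i, Finset.mem_univ _, ?_⟩
    · by_cases hki : k = i <;> by_cases hkj : k = j <;> simp_all <;> omega
    · simp [hij]; omega
  have hle : ∀ i, a i ≤ c i := by
    by_contra! h
    obtain ⟨i, hi⟩ := h
    let U : Finset (Fin n) := {k | Exch P a i k}
    have hU : ∀ k, k ∈ U ↔ Exch P a i k := fun k => by simp [U]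
    refine (hsum U fun k l hkl hk => (hU l).2 (hP.exch_trans ha ((hU k).1 hk) hkl)).not_gt ?_
    refine Finset.sum_lt_sum (fun k hk => ?_) ⟨i, (hU i).2 (exch_refl ha i), hi⟩
    by_contra! h
    exact hno i k hi h ((hU k).1 hk)
  have hge : ∑ k, c k ≤ ∑ k, a k := by
    have := sum_le_of_mem_polytope (fun b hb => (hP.sum_eq ha hb).ge) hc
    simp only [toReal] at this
    exact_mod_cast this
  have heq : ∀ i ∈ Finset.univ, a i = c i :=
    (Finset.sum_eq_sum_iff_of_le fun i _ => hle i).1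
      (le_antisymm (Finset.sum_le_sum fun i _ => hle i) hge)
  rwa [show c = a from funext fun i => (heq i (Finset.mem_univ i)).symm]

lemma IsPolymatroid.latticePoints_polytope (hP : IsPolymatroid P) :
    latticePoints (polytope P) = P :=
  Set.ext fun _ => hP.toReal_mem_polytope_iff

end Polytope

/-! ### The relative interior -/

section RelativeInterior

open Filter Topology

/-- A segment that starts in the relative interior can be prolonged backwards. -/
lemma eventually_lineMap_mem {E : Type*} [NormedAddCommGroup E] [NormedSpace ℝ E] {S : Set E}
    {x z : E} (hx : x ∈ intrinsicInterior ℝ S) (hz : z ∈ S) :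
    ∀ᶠ t in 𝓝 (0 : ℝ), AffineMap.lineMap x z t ∈ S := by
  obtain ⟨y, hy, rfl⟩ := mem_intrinsicInterior.1 hx
  let γ : ℝ → affineSpan ℝ S := fun t =>
    ⟨AffineMap.lineMap (y : E) z t, AffineMap.lineMap_mem t y.2 (subset_affineSpan ℝ S hz)⟩
  have hγ : Continuous γ := Continuous.subtype_mk AffineMap.lineMap_continuous _
  have h0 : γ 0 = y := Subtype.ext (AffineMap.lineMap_apply_zero _ _)
  have hmem : interior ((↑) ⁻¹' S : Set (affineSpan ℝ S)) ∈ 𝓝 (γ 0) := by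
    rw [h0]
    exact isOpen_interior.mem_nhds hy
  filter_upwards [hγ.continuousAt.preimage_mem_nhds hmem] with t ht
  have ht' : γ t ∈ ((↑) ⁻¹' S : Set (affineSpan ℝ S)) := interior_subset ht
  exact ht'

lemma lineMap_mem_intrinsicInterior {E : Type*} [NormedAddCommGroup E] [NormedSpace ℝ E] {S : Set E}
    (hS : Convex ℝ S) {c z : E} (hc : c ∈ intrinsicInterior ℝ S) (hz : z ∈ S) {t : ℝ} (ht : 0 < t)
    (ht' : t ≤ 1) : AffineMap.lineMap z c t ∈ intrinsicInterior ℝ S := by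
  obtain ⟨c, hc', rfl⟩ := mem_intrinsicInterior.1 hc
  have hx : AffineMap.lineMap z (c : E) t ∈ affineSpan ℝ S :=
    AffineMap.lineMap_mem t (subset_affineSpan ℝ S hz) c.2
  refine mem_intrinsicInterior.2 ⟨⟨_, hx⟩, ?_, rfl⟩
  -- the homothety with ratio `t⁻¹` and centre `z`
  let g : affineSpan ℝ S → affineSpan ℝ S := fun y =>
    ⟨t⁻¹ • ((y : E) -ᵥ AffineMap.lineMap z (c : E) t) +ᵥ (c : E),
    (affineSpan ℝ S).smul_vsub_vadd_mem _ y.2 hx c.2⟩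
  have hg : Continuous g := by
    refine Continuous.subtype_mk ?_ _
    simp only [vsub_eq_sub, vadd_eq_add]
    fun_prop
  refine mem_interior.2 ⟨g ⁻¹' interior ((↑) ⁻¹' S : Set (affineSpan ℝ S)), ?_,
    isOpen_interior.preimage hg, ?_⟩
  · intro y hy
    have hy' : g y ∈ ((↑) ⁻¹' S : Set (affineSpan ℝ S)) := interior_subset hy
    have hy'' : (g y : E) ∈ S := hy'
    have : AffineMap.lineMap z (g y : E) t = (y : E) := by
      simp only [g, AffineMap.lineMap_apply, vsub_eq_sub, vadd_eq_add]
      rw [add_sub_assoc, smul_add, smul_smul, mul_inv_cancel₀ ht.ne', one_smul]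
      abel
    change (y : E) ∈ S
    rw [← this]
    exact hS.lineMap_mem hz hy'' ⟨ht.le, ht'⟩
  · have hgx : g ⟨_, hx⟩ = c := by
      ext
      simp [g]
    change g ⟨_, hx⟩ ∈ interior ((↑) ⁻¹' S : Set (affineSpan ℝ S))
    rw [hgx]
    exact hc'

variable {n : ℕ} {P : Finset (Fin n → ℤ)} {a : Fin n → ℤ}

/-- The arrows at `a` can be reversed, so that they form an equivalence relation. For a polymatroid
this means that `a` lies in the relative interior of the convex hull. -/
def SymmExch (P : Finset (Fin n → ℤ)) (a : Fin n → ℤ) : Prop :=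
  ∀ i j, Exch P a i j → Exch P a j i

lemma IsPolymatroid.symmExch_of_mem_intrinsicInterior (hP : IsPolymatroid P) (ha : a ∈ P)
    (h : toReal a ∈ intrinsicInterior ℝ (polytope P)) : SymmExch P a := by
  classical
  intro i j hij
  by_contra hji
  let U : Finset (Fin n) := {k | Exch P a j k}
  have hU : ∀ k, k ∈ U ↔ Exch P a j k := fun k => by simp [U]
  have hmin : ∀ b ∈ P, ∑ k ∈ U, a k ≤ ∑ k ∈ U, b k := fun b hb =>
    hP.sum_le_of_closed ha (fun k l hkl hk => (hU l).2 (hP.exch_trans ha ((hU k).1 hk) hkl)) hb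
  have hline := eventually_lineMap_mem h (toReal_mem_polytope hij)
  obtain ⟨t, ht, ht'⟩ := ((hline.filter_mono nhdsWithin_le_nhds).and
    (self_mem_nhdsWithin (s := Set.Iio (0 : ℝ)))).exists
  have := le_sum_of_mem_polytope hmin ht
  rw [toReal_add_single, toReal_sub_single] at this
  simp only [AffineMap.lineMap_apply, vsub_eq_sub, vadd_eq_add, Pi.add_apply, Pi.smul_apply,
    Pi.sub_apply, Finset.sum_add_distrib, smul_eq_mul, ← Finset.mul_sum, Finset.sum_sub_distrib,
    Finset.sum_pi_single', toReal, (hU j).2 (exch_refl ha j), mt (hU i).1 hji, if_true, if_false]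
    at this
  push_cast at this
  have ht' : t < 0 := ht'
  linarith

/-- If from `a` one can move a little against `v` and a little against `w` within the polytope, then
one can do so with the same step length. -/
lemma exists_sub_smul_mem (ha : a ∈ P) {v w : Fin n → ℝ}
    (hv : ∃ ε > (0 : ℝ), toReal a - ε • v ∈ polytope P)
    (hw : ∃ ε > (0 : ℝ), toReal a - ε • w ∈ polytope P) :
    ∃ ε > (0 : ℝ), toReal a - ε • v ∈ polytope P ∧ toReal a - ε • w ∈ polytope P := by
  have shrink : ∀ (u : Fin n → ℝ) (ε δ : ℝ), 0 < δ → δ ≤ ε → toReal a - ε • u ∈ polytope P →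
      toReal a - δ • u ∈ polytope P := by
    intro u ε δ hδ hle h
    have := convex_polytope.lineMap_mem (toReal_mem_polytope ha) h
      (t := δ / ε) ⟨by have := hδ.trans_le hle; positivity, div_le_one_of_le₀ hle (by linarith)⟩
    convert this using 1
    have : ε ≠ 0 := by linarith
    rw [AffineMap.lineMap_apply, vsub_eq_sub, vadd_eq_add, sub_sub_cancel_left, smul_neg, smul_smul,
      div_mul_cancel₀ _ this]
    abel
  obtain ⟨ε, hε, hv⟩ := hv
  obtain ⟨δ, hδ, hw⟩ := hw
  have := lt_min hε hδ
  exact ⟨min ε δ, this, shrink _ _ _ this (min_le_left _ _) hv,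
    shrink _ _ _ this (min_le_right _ _) hw⟩

/-- If the arrows at `a` are reversible, then every segment of the polytope that ends in `a` can be
prolonged beyond `a`. -/
lemma IsPolymatroid.exists_sub_smul_mem (hP : IsPolymatroid P) (ha : a ∈ P) (h : SymmExch P a)
    {x : Fin n → ℝ} (hx : x ∈ polytope P) :
    ∃ ε > (0 : ℝ), toReal a - ε • (x - toReal a) ∈ polytope P := by
  have hconv : Convex ℝ {x | ∃ ε > (0 : ℝ), toReal a - ε • (x - toReal a) ∈ polytope P} := by
    intro x hx y hy s t hs ht hst
    obtain ⟨ε, hε, h₁, h₂⟩ := PolymatroidTutte.exists_sub_smul_mem ha hx hy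
    refine ⟨ε, hε, ?_⟩
    convert convex_polytope h₁ h₂ hs ht hst using 1
    obtain rfl : s = 1 - t := by linarith
    module
  refine convexHull_min ?_ hconv hx
  rintro _ ⟨b, hb, rfl⟩
  refine hP.path_induction ha
    (motive := fun b => ∃ ε > (0 : ℝ), toReal a - ε • (toReal b - toReal a) ∈ polytope P)
    ⟨1, one_pos, by simpa using toReal_mem_polytope ha⟩ (fun b i j hij hb => ?_) hb
  have hji : ∃ ε > (0 : ℝ), toReal a - ε • (Pi.single j 1 - Pi.single i 1) ∈ polytope P := by
    refine ⟨1, one_pos, ?_⟩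
    have := toReal_mem_polytope (h i j hij)
    rw [toReal_add_single, toReal_sub_single] at this
    convert this using 1
    rw [one_smul]
    abel
  obtain ⟨ε, hε, h₁, h₂⟩ := PolymatroidTutte.exists_sub_smul_mem ha hb hji
  refine ⟨ε / 2, by positivity, ?_⟩
  convert convex_polytope h₁ h₂ (by norm_num : (0 : ℝ) ≤ 1 / 2) (by norm_num : (0 : ℝ) ≤ 1 / 2)
    (by norm_num) using 1
  rw [toReal_add_single, toReal_sub_single]
  module

lemma IsPolymatroid.toReal_mem_intrinsicInterior_iff (hP : IsPolymatroid P) :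
    toReal a ∈ intrinsicInterior ℝ (polytope P) ↔ a ∈ P ∧ SymmExch P a := by
  constructor
  · intro h
    have ha : a ∈ P := hP.toReal_mem_polytope_iff.1 (intrinsicInterior_subset h)
    exact ⟨ha, hP.symmExch_of_mem_intrinsicInterior ha h⟩
  · rintro ⟨ha, h⟩
    obtain ⟨c, hc⟩ := Set.Nonempty.intrinsicInterior (convex_polytope (P := P))
      ⟨_, toReal_mem_polytope ha⟩
    obtain ⟨ε, hε, hz⟩ := hP.exists_sub_smul_mem ha h (intrinsicInterior_subset hc)
    have := lineMap_mem_intrinsicInterior convex_polytope hc hz (t := ε / (1 + ε))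
      (by positivity) (div_le_one_of_le₀ (by linarith) (by positivity))
    convert this using 1
    ext k
    simp only [AffineMap.lineMap_apply, vsub_eq_sub, vadd_eq_add, Pi.add_apply, Pi.smul_apply,
      Pi.sub_apply, smul_eq_mul]
    field_simp
    ring

end RelativeInterior

/-! ### Codimension and activities -/

section Codim

variable {n : ℕ} {P : Finset (Fin n → ℤ)} {a : Fin n → ℤ}

lemma single_sub_single_mem_vectorSpan (ha : a ∈ P) {i j : Fin n} (h : Exch P a i j) :
    (Pi.single j 1 - Pi.single i 1 : Fin n → ℝ) ∈ vectorSpan ℝ (polytope P) := by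
  have := vsub_mem_vectorSpan ℝ (toReal_mem_polytope h) (toReal_mem_polytope ha)
  rw [toReal_add_single, toReal_sub_single, vsub_eq_sub] at this
  convert this using 1
  abel

/-- If `i` is not active on both sides, then `e_i - e_j` is parallel to the polytope for some
`j < i`. Hence the direction of the polytope and the basis vectors of the doubly active indices
together span the whole space. -/
lemma codim_le_card (ha : a ∈ P) : codim P ≤ (intAct P a ∩ extAct P a).card := by
  classical
  set V := vectorSpan ℝ (polytope P) with hV
  set Z := intAct P a ∩ extAct P a with hZ
  let W : Submodule ℝ (Fin n → ℝ) :=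
    Submodule.span ℝ (Z.image fun z => (Pi.single z 1 : Fin n → ℝ) : Finset (Fin n → ℝ))
  have hmem : ∀ i : Fin n, (Pi.single i 1 : Fin n → ℝ) ∈ V ⊔ W := by
    intro i
    induction i using Fin.strong_induction_on with
    | _ i ih =>
      by_cases hi : i ∈ Z
      · exact Submodule.mem_sup_right (Submodule.subset_span
          (Finset.mem_coe.2 (Finset.mem_image_of_mem _ hi)))
      obtain ⟨j, hj, h⟩ : ∃ j < i, (Pi.single i 1 - Pi.single j 1 : Fin n → ℝ) ∈ V := by
        rw [hZ, Finset.mem_inter, not_and_or, mem_intAct, mem_extAct] at hi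
        push Not at hi
        rcases hi with ⟨j, hj, h⟩ | ⟨j, hj, h⟩
        · exact ⟨j, hj, by simpa using neg_mem (single_sub_single_mem_vectorSpan ha h)⟩
        · exact ⟨j, hj, single_sub_single_mem_vectorSpan ha h⟩
      simpa using add_mem (Submodule.mem_sup_left h) (ih j hj)
  have htop : V ⊔ W = ⊤ := by
    rw [eq_top_iff, ← (Pi.basisFun ℝ (Fin n)).span_eq, Submodule.span_le]
    rintro _ ⟨i, rfl⟩
    simpa using hmem i
  have h₁ := Submodule.finrank_add_le_finrank_add_finrank V W
  rw [htop, finrank_top, Module.finrank_fin_fun] at h₁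
  have h₂ : Module.finrank ℝ W ≤ Z.card :=
    (finrank_span_finset_le_card _).trans Finset.card_image_le
  rw [codim, ← hV]
  omega

lemma IsPolymatroid.codim_eq_card (hP : IsPolymatroid P) (ha : a ∈ P) (hs : SymmExch P a) :
    codim P = (intAct P a).card := by
  classical
  refine le_antisymm ((codim_le_card ha).trans (Finset.card_le_card Finset.inter_subset_left)) ?_
  have hne : ∀ i, (Finset.univ.filter (Exch P a i)).Nonempty := fun i =>
    ⟨i, by simpa using exch_refl ha i⟩
  -- the smallest element of the class of `i`
  let m : Fin n → Fin n := fun i => (Finset.univ.filter (Exch P a i)).min' (hne i)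
  have hm : ∀ i, Exch P a i (m i) := fun i => by
    simpa using Finset.min'_mem _ (hne i)
  have hm_eq : ∀ i j, Exch P a i j → m i = m j := by
    intro i j hij
    have : Finset.univ.filter (Exch P a i) = Finset.univ.filter (Exch P a j) := by
      ext k
      simpa using ⟨hP.exch_trans ha (hs _ _ hij), hP.exch_trans ha hij⟩
    simp only [m, this]
  have hm_int : ∀ i ∈ intAct P a, m i = i := by
    intro i hi
    refine le_antisymm (Finset.min'_le _ _ (by simpa using exch_refl ha i)) ?_
    by_contra! h
    exact mem_intAct.1 hi _ h (hm i)
  let T : Finset (Fin n → ℝ) :=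
    (intAct P a)ᶜ.image fun i => Pi.single (m i) 1 - Pi.single i 1
  have hT : ∀ i, (Pi.single (m i) 1 - Pi.single i 1 : Fin n → ℝ) ∈
      Submodule.span ℝ (T : Set _) := by
    intro i
    by_cases hi : i ∈ intAct P a
    · rw [hm_int i hi, sub_self]
      exact zero_mem _
    · exact Submodule.subset_span (Finset.mem_coe.2 (Finset.mem_image_of_mem _ (by simpa using hi)))
  have hle : vectorSpan ℝ (polytope P) ≤ Submodule.span ℝ (T : Set _) := by
    rw [polytope, ← direction_affineSpan, affineSpan_convexHull, direction_affineSpan,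
      vectorSpan_eq_span_vsub_set_right ℝ (Set.mem_image_of_mem toReal (Finset.mem_coe.2 ha)),
      Submodule.span_le]
    rintro _ ⟨_, ⟨b, hb, rfl⟩, rfl⟩
    refine hP.path_induction ha
      (motive := fun b => toReal b - toReal a ∈ Submodule.span ℝ (T : Set (Fin n → ℝ)))
      (by rw [sub_self]; exact zero_mem _) (fun b i j hij hb => ?_) hb
    have := add_mem hb (sub_mem (hT i) (hT j))
    rw [toReal_add_single, toReal_sub_single, hm_eq i j hij] at this
    convert this using 1
    abel
  have h₁ := Submodule.finrank_mono hle
  have h₂ : Module.finrank ℝ (Submodule.span ℝ (T : Set (Fin n → ℝ))) ≤ (intAct P a)ᶜ.card :=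
    (finrank_span_finset_le_card _).trans Finset.card_image_le
  rw [Finset.card_compl, Fintype.card_fin] at h₂
  have h₃ := Finset.card_le_univ (intAct P a)
  rw [Fintype.card_fin] at h₃
  rw [codim]
  omega

lemma pow_codim_dvd_tutte (P : Finset (Fin n → ℤ)) : (X 0 + X 1 - 1) ^ codim P ∣ tutte P :=
  Finset.dvd_sum fun _ ha => Dvd.dvd.mul_left (pow_dvd_pow _ (codim_le_card ha)) _

end Codim

/-! ### The values at `(1, 1)` and `(0, 0)` -/

lemma eval_one_one_tutte {n : ℕ} (P : Finset (Fin n → ℤ)) :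
    eval ![1, 1] (tutte P) = (P.card : ℤ) := by
  simp [tutte]

section SliceSymm

variable {n : ℕ} {P : Finset (Fin (n + 1) → ℤ)} {k : ℤ} {c : Fin n → ℤ}

lemma card_intAct_insertNth :
    (intAct P ((Fin.last n).insertNth (α := fun _ => ℤ) k c)).card =
      (if Fin.last n ∈ intAct P ((Fin.last n).insertNth (α := fun _ => ℤ) k c) then 1 else 0) +
        (intAct (slice P (Fin.last n) k) c).card := by
  have hcard : ∀ {n : ℕ} (S : Finset (Fin n)), S.card = ∑ i, if i ∈ S then 1 else 0 := by simp
  rw [hcard, hcard, Fin.sum_univ_succAbove _ (Fin.last n)]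
  simp only [succAbove_mem_intAct]

/-- Reversibility of the arrows and slicing at the last index: an element with reversible arrows
either has an isolated last index, or is an element of a proper slice with reversible arrows. -/
lemma IsPolymatroid.symmExch_insertNth (hP : IsPolymatroid P)
    (hc : c ∈ PolymatroidTutte.slice P (Fin.last n) k) :
    SymmExch P ((Fin.last n).insertNth (α := fun _ => ℤ) k c) ↔
      SymmExch (PolymatroidTutte.slice P (Fin.last n) k) c ∧
        (Fin.last n ∈ intAct P ((Fin.last n).insertNth (α := fun _ => ℤ) k c) ↔
          Fin.last n ∈ extAct P ((Fin.last n).insertNth (α := fun _ => ℤ) k c)) := by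
  have ha := mem_slice.1 hc
  set a := (Fin.last n).insertNth (α := fun _ => ℤ) k c
  have hslice : SymmExch (PolymatroidTutte.slice P (Fin.last n) k) c ↔
      ∀ i j : Fin n, Exch P a ((Fin.last n).succAbove i) ((Fin.last n).succAbove j) →
        Exch P a ((Fin.last n).succAbove j) ((Fin.last n).succAbove i) := by
    simp only [SymmExch, exch_slice]
    rfl
  rw [hslice]
  have hlt : ∀ j : Fin n, (Fin.last n).succAbove j < Fin.last n := fun j =>
    lt_of_le_of_ne (Fin.le_last _) (Fin.succAbove_ne _ _)
  constructor
  · intro h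
    refine ⟨fun i j => h _ _, ?_⟩
    rw [mem_intAct, mem_extAct]
    exact ⟨fun H j hj hE => H j hj (h _ _ hE), fun H j hj hE => H j hj (h _ _ hE)⟩
  · rintro ⟨h, hiff⟩
    by_cases hI : Fin.last n ∈ intAct P a
    · have hE := hiff.1 hI
      rw [mem_intAct] at hI
      rw [mem_extAct] at hE
      intro i j hij
      rcases Fin.eq_self_or_eq_succAbove (Fin.last n) i with rfl | ⟨i, rfl⟩ <;>
        rcases Fin.eq_self_or_eq_succAbove (Fin.last n) j with rfl | ⟨j, rfl⟩
      · exact hij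
      · exact absurd hij (hI _ (hlt j))
      · exact absurd hij (hE _ (hlt i))
      · exact h _ _ hij
    · have hE := mt hiff.2 hI
      rw [mem_intAct] at hI
      rw [mem_extAct] at hE
      push Not at hI hE
      obtain ⟨j₁, hj₁, h₁⟩ := hI
      obtain ⟨j₂, hj₂, h₂⟩ := hE
      obtain ⟨j₁, rfl⟩ := Fin.exists_succAbove_eq hj₁.ne
      obtain ⟨j₂, rfl⟩ := Fin.exists_succAbove_eq hj₂.ne
      -- the last index is in one class with `j₁` and `j₂`
      have h₁₂ := h _ _ (hP.exch_trans ha h₂ h₁)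
      have h₁' := hP.exch_trans ha h₁₂ h₂
      intro i j hij
      rcases Fin.eq_self_or_eq_succAbove (Fin.last n) i with rfl | ⟨i, rfl⟩ <;>
        rcases Fin.eq_self_or_eq_succAbove (Fin.last n) j with rfl | ⟨j, rfl⟩
      · exact hij
      · exact hP.exch_trans ha (h _ _ (hP.exch_trans ha h₁' hij)) h₁'
      · exact hP.exch_trans ha h₁ (h _ _ (hP.exch_trans ha hij h₁))
      · exact h _ _ hij

end SliceSymm

/-- The value at the origin, by slicing at the last index: the ends of the range of the last
coordinate do not contribute unless they coincide. -/
lemma IsPolymatroid.eval_zero_zero_tutte_eq_sum {n : ℕ} {P : Finset (Fin n → ℤ)}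
    (hP : IsPolymatroid P) [DecidablePred (SymmExch P)] :
    eval ![0, 0] (tutte P) =
      ∑ a ∈ P, if SymmExch P a then (-1 : ℤ) ^ (intAct P a).card else 0 := by
  classical
  induction n with
  | zero =>
    rw [tutte_eq_sum_prod]
    have : ∀ a, SymmExch P a := fun a i => i.elim0
    simp [this, Finset.eq_empty_of_isEmpty]
  | succ n ih =>
    have hK : ∀ a ∈ P, a (Fin.last n) ∈ P.image (· (Fin.last n)) := fun a ha =>
      Finset.mem_image_of_mem _ ha
    rw [hP.tutte_eq_sum_slice_last hK, sum_eq_sum_slice P (Fin.last n) hK, map_sum]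
    refine Finset.sum_congr rfl fun k hk => ?_
    obtain ⟨a, ha, rfl⟩ := Finset.mem_image.1 hk
    rw [map_mul, ih (hP.slice ha rfl), Finset.mul_sum]
    refine Finset.sum_congr rfl fun c hc => ?_
    rw [← hP.actWt_last hc, card_intAct_insertNth]
    simp only [hP.symmExch_insertNth hc, actWt]
    generalize (Fin.last n).insertNth (α := fun _ => ℤ) (a (Fin.last n)) c = b
    by_cases hs : SymmExch (PolymatroidTutte.slice P (Fin.last n) (a (Fin.last n))) c <;>
    by_cases hI : Fin.last n ∈ intAct P b <;> by_cases hE : Fin.last n ∈ extAct P b <;>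
    simp [hs, hI, hE, pow_add]

lemma IsPolymatroid.eval_zero_zero_tutte {n : ℕ} {P : Finset (Fin n → ℤ)} (hP : IsPolymatroid P) :
    eval ![0, 0] (tutte P) =
      (-1) ^ codim P * ((latticePoints (intrinsicInterior ℝ (polytope P))).ncard : ℤ) := by
  classical
  have : latticePoints (intrinsicInterior ℝ (polytope P)) =
      (P.filter (SymmExch P) : Finset (Fin n → ℤ)) := by
    ext a
    rw [latticePoints, Finset.mem_coe, Finset.mem_filter]
    exact hP.toReal_mem_intrinsicInterior_iff
  rw [this, Set.ncard_coe_finset, hP.eval_zero_zero_tutte_eq_sum, ← Finset.sum_filter,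
    Finset.sum_congr rfl (g := fun _ => (-1 : ℤ) ^ codim P), Finset.sum_const, nsmul_eq_mul,
    mul_comm]
  intro a ha
  rw [Finset.mem_filter] at ha
  rw [hP.codim_eq_card ha.1 ha.2]

/-! ### The quotient by `x + y - 1` and Minkowski differences -/

section Quotient

variable {n : ℕ} {P : Finset (Fin (n + 1) → ℤ)}

lemma zero_mem_intAct (a : Fin (n + 1) → ℤ) : 0 ∈ intAct P a :=
  mem_intAct.2 fun j hj => absurd hj (Fin.zero_le j).not_gt

lemma zero_mem_extAct (a : Fin (n + 1) → ℤ) : 0 ∈ extAct P a :=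
  mem_extAct.2 fun j hj => absurd hj (Fin.zero_le j).not_gt

/-- The quotient of the Tutte polynomial by `x + y - 1`: the smallest index is always active on both
sides, so every summand has this factor. -/
noncomputable def tutteQuotient (P : Finset (Fin (n + 1) → ℤ)) : MvPolynomial (Fin 2) ℤ :=
  ∑ a ∈ P, X 0 ^ (intAct P a \ extAct P a).card * X 1 ^ (extAct P a \ intAct P a).card *
    (X 0 + X 1 - 1) ^ ((intAct P a ∩ extAct P a).card - 1)

lemma tutte_eq_mul_tutteQuotient (P : Finset (Fin (n + 1) → ℤ)) :
    tutte P = (X 0 + X 1 - 1) * tutteQuotient P := by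
  rw [tutte, tutteQuotient, Finset.mul_sum]
  refine Finset.sum_congr rfl fun a _ => ?_
  have : (intAct P a ∩ extAct P a).card ≠ 0 :=
    Finset.card_ne_zero_of_mem (Finset.mem_inter.2 ⟨zero_mem_intAct a, zero_mem_extAct a⟩)
  conv_lhs => rw [← mul_pow_sub_one this]
  ring

/-- If every positive index has an arrow to a smaller index, then by transitivity it has one to
`0`. -/
lemma IsPolymatroid.intAct_eq_singleton_iff (hP : IsPolymatroid P) {a : Fin (n + 1) → ℤ}
    (ha : a ∈ P) : intAct P a = {0} ↔ ∀ i, Exch P a i 0 := by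
  constructor
  · intro h i
    induction i using Fin.strong_induction_on with
    | _ i ih =>
      by_cases hi : i = 0
      · exact hi ▸ exch_refl ha 0
      have : i ∉ intAct P a := by simpa [h] using hi
      rw [mem_intAct] at this
      push Not at this
      obtain ⟨j, hj, hij⟩ := this
      exact hP.exch_trans ha hij (ih j hj)
  · intro h
    refine Finset.eq_singleton_iff_unique_mem.2 ⟨zero_mem_intAct a, fun i hi => ?_⟩
    by_contra hne
    exact mem_intAct.1 hi 0 (Fin.pos_of_ne_zero hne) (h i)

lemma IsPolymatroid.extAct_eq_singleton_iff (hP : IsPolymatroid P) {a : Fin (n + 1) → ℤ}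
    (ha : a ∈ P) : extAct P a = {0} ↔ ∀ i, Exch P a 0 i := by
  constructor
  · intro h i
    induction i using Fin.strong_induction_on with
    | _ i ih =>
      by_cases hi : i = 0
      · exact hi ▸ exch_refl ha 0
      have : i ∉ extAct P a := by simpa [h] using hi
      rw [mem_extAct] at this
      push Not at this
      obtain ⟨j, hj, hij⟩ := this
      exact hP.exch_trans ha (ih j hj) hij
  · intro h
    refine Finset.eq_singleton_iff_unique_mem.2 ⟨zero_mem_extAct a, fun i hi => ?_⟩
    by_contra hne
    exact mem_extAct.1 hi 0 (Fin.pos_of_ne_zero hne) (h i)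

lemma card_sdiff_eq_zero_iff {S T : Finset (Fin (n + 1))} (hS : 0 ∈ S) (hT : 0 ∈ T) :
    ((S \ T).card = 0 ∧ (T ∩ S).card - 1 = 0) ↔ S = {0} := by
  have h0 : 0 < (T ∩ S).card := Finset.card_pos.2 ⟨0, Finset.mem_inter.2 ⟨hT, hS⟩⟩
  have h1 := Finset.card_sdiff_add_card_inter S T
  rw [Finset.inter_comm] at h1
  have h2 : S = {0} ↔ S.card = 1 := by
    rw [Finset.card_eq_one]
    refine ⟨fun h => ⟨0, h⟩, ?_⟩
    rintro ⟨s, rfl⟩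
    rw [Finset.mem_singleton.1 hS]
  rw [h2]
  omega

lemma eval_tutteQuotient_one_zero (P : Finset (Fin (n + 1) → ℤ)) :
    eval ![1, 0] (tutteQuotient P) = ({a ∈ P | extAct P a = {0}} : Finset _).card := by
  rw [Finset.card_filter, tutteQuotient, map_sum]
  push_cast
  refine Finset.sum_congr rfl fun a _ => ?_
  have := card_sdiff_eq_zero_iff (zero_mem_extAct (P := P) a) (zero_mem_intAct (P := P) a)
  simp only [map_mul, map_pow, map_add, map_sub, map_one, eval_X, Matrix.cons_val_zero,
    Matrix.cons_val_one, one_pow, one_mul, add_zero, sub_self, zero_pow_eq, ← this]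
  split_ifs <;> simp_all

lemma eval_tutteQuotient_zero_one (P : Finset (Fin (n + 1) → ℤ)) :
    eval ![0, 1] (tutteQuotient P) = ({a ∈ P | intAct P a = {0}} : Finset _).card := by
  rw [Finset.card_filter, tutteQuotient, map_sum]
  push_cast
  refine Finset.sum_congr rfl fun a _ => ?_
  have := card_sdiff_eq_zero_iff (zero_mem_intAct (P := P) a) (zero_mem_extAct (P := P) a)
  rw [Finset.inter_comm] at this
  simp only [map_mul, map_pow, map_add, map_sub, map_one, eval_X, Matrix.cons_val_zero,
    Matrix.cons_val_one, one_pow, mul_one, zero_add, sub_self, zero_pow_eq, ← this]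
  split_ifs <;> simp_all

lemma IsPolymatroid.toReal_mem_minkowskiDiff_iff {n : ℕ} {P : Finset (Fin n → ℤ)}
    (hP : IsPolymatroid P) {D : Set (Fin n → ℝ)} {u : Fin n → Fin n → ℤ}
    (hD : D = convexHull ℝ (Set.range fun i => toReal (u i))) {c : Fin n → ℤ} :
    toReal c ∈ minkowskiDiff (polytope P) D ↔ ∀ i, c + u i ∈ P := by
  have hadd : ∀ b : Fin n → ℤ, toReal c + toReal b = toReal (c + b) := fun b => by
    ext; simp [toReal]
  subst hD
  constructor
  · intro h i
    have := h _ (subset_convexHull ℝ _ ⟨i, rfl⟩)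
    rwa [hadd, hP.toReal_mem_polytope_iff] at this
  · intro h d hd
    refine convexHull_min ?_ (convex_polytope.translate_preimage_right (toReal c)) hd
    rintro _ ⟨i, rfl⟩
    change toReal c + _ ∈ polytope P
    rw [hadd, hP.toReal_mem_polytope_iff]
    exact h i

lemma IsPolymatroid.latticePoints_minkowskiDiff_simplex (hP : IsPolymatroid P) :
    latticePoints (minkowskiDiff (polytope P) (simplex (n + 1))) =
      ({a ∈ P | extAct P a = {0}}.image (· - Pi.single 0 1) : Finset (Fin (n + 1) → ℤ)) := by
  ext c
  have hD : simplex (n + 1) = convexHull ℝ (Set.range fun i => toReal (Pi.single i 1)) := by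
    rw [simplex]
    congr! 3 with i
    simpa [toReal_zero] using (toReal_add_single (a := 0) i).symm
  rw [latticePoints, Set.mem_ofPred_eq, hP.toReal_mem_minkowskiDiff_iff hD]
  simp only [Finset.coe_image, Finset.coe_filter, Set.mem_image, Set.mem_ofPred_eq]
  constructor
  · intro h
    refine ⟨c + Pi.single 0 1, ⟨h 0, (hP.extAct_eq_singleton_iff (h 0)).2 fun i => ?_⟩, by simp⟩
    simpa [Exch] using h i
  · rintro ⟨a, ⟨ha, h⟩, rfl⟩
    exact (hP.extAct_eq_singleton_iff ha).1 h

lemma IsPolymatroid.latticePoints_minkowskiDiff_revSimplex (hP : IsPolymatroid P) :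
    latticePoints (minkowskiDiff (polytope P) (revSimplex (n + 1))) =
      ({a ∈ P | intAct P a = {0}}.image (· + Pi.single 0 1) : Finset (Fin (n + 1) → ℤ)) := by
  ext c
  have hD : revSimplex (n + 1) = convexHull ℝ (Set.range fun i => toReal (-Pi.single i 1)) := by
    rw [revSimplex]
    congr! 3 with i
    simpa [toReal_zero] using (toReal_sub_single (a := 0) i).symm
  rw [latticePoints, Set.mem_ofPred_eq, hP.toReal_mem_minkowskiDiff_iff hD]
  simp only [Finset.coe_image, Finset.coe_filter, Set.mem_image, Set.mem_ofPred_eq,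
    ← sub_eq_add_neg]
  constructor
  · intro h
    refine ⟨c - Pi.single 0 1, ⟨h 0, (hP.intAct_eq_singleton_iff (h 0)).2 fun i => ?_⟩, by simp⟩
    rw [exch_iff']
    simpa using h i
  · rintro ⟨a, ⟨ha, h⟩, rfl⟩ i
    exact exch_iff'.1 ((hP.intAct_eq_singleton_iff ha).1 h i)

end Quotient

/-! ### The top homogeneous component -/

/-- The polynomials all of whose monomials have degree less than `n`. -/
noncomputable def lowDeg (n : ℕ) : AddSubgroup (MvPolynomial (Fin 2) ℤ) where
  carrier := {p | ∀ d : Fin 2 →₀ ℕ, n ≤ d.degree → coeff d p = 0}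
  zero_mem' := fun d _ => coeff_zero d
  add_mem' := fun hp hq d hd => by rw [coeff_add, hp d hd, hq d hd, add_zero]
  neg_mem' := fun hp d hd => by rw [coeff_neg, hp d hd, neg_zero]

lemma lowDeg_succ {n : ℕ} {p : MvPolynomial (Fin 2) ℤ} (h : p ∈ lowDeg n) : p ∈ lowDeg (n + 1) :=
  fun d hd => h d (by omega)

lemma X_mul_mem_lowDeg {n : ℕ} {p : MvPolynomial (Fin 2) ℤ} (h : p ∈ lowDeg n) (i : Fin 2) :
    X i * p ∈ lowDeg (n + 1) := by
  intro d hd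
  rw [coeff_X_mul']
  split_ifs with hi
  · refine h _ ?_
    have h₁ : Finsupp.single i 1 ≤ d := by
      rw [Finsupp.single_le_iff]
      exact Nat.one_le_iff_ne_zero.2 (Finsupp.mem_support_iff.1 hi)
    have h₂ := congrArg Finsupp.degree (tsub_add_cancel_of_le h₁)
    rw [map_add, Finsupp.degree_single] at h₂
    omega
  · rfl

lemma isHomogeneous_add_pow (n : ℕ) :
    ((X 0 + X 1 : MvPolynomial (Fin 2) ℤ) ^ n).IsHomogeneous n := by
  simpa using ((isHomogeneous_X ℤ (0 : Fin 2)).add (isHomogeneous_X ℤ (1 : Fin 2))).pow n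

lemma add_pow_mem_lowDeg (n : ℕ) : (X 0 + X 1 : MvPolynomial (Fin 2) ℤ) ^ n ∈ lowDeg (n + 1) :=
  fun d hd => (isHomogeneous_add_pow n).coeff_eq_zero (by omega)

lemma endWt_mul_mem_lowDeg {n : ℕ} {p : MvPolynomial (Fin 2) ℤ} (h : p ∈ lowDeg n) (S : ℤ → Prop)
    (k : ℤ) : endWt S k * p ∈ lowDeg (n + 1) := by
  classical
  have hX : ∀ i, (X i - 1) * p ∈ lowDeg (n + 1) := fun i => by
    rw [sub_mul, one_mul]
    exact sub_mem (X_mul_mem_lowDeg h i) (lowDeg_succ h)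
  rw [endWt, add_mul, add_mul, one_mul]
  refine add_mem (add_mem (lowDeg_succ h) ?_) ?_
  · split_ifs
    · rw [zero_mul]; exact zero_mem _
    · exact hX 0
  · split_ifs
    · rw [zero_mul]; exact zero_mem _
    · exact hX 1

lemma sum_endWt {K : Finset ℤ} (hK : K.Nonempty) :
    ∑ k ∈ K, endWt (· ∈ K) k = X 0 + X 1 + ((K.card : MvPolynomial (Fin 2) ℤ) - 2) := by
  classical
  simp only [endWt, Finset.sum_add_distrib]
  rw [Finset.sum_const, Finset.sum_eq_single (K.min' hK), Finset.sum_eq_single (K.max' hK),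
    if_neg, if_neg]
  · simp only [nsmul_eq_mul, mul_one]
    ring
  · rintro ⟨k, hk, h⟩
    exact (K.le_max' k h).not_gt hk
  · rintro ⟨k, hk, h⟩
    exact (K.min'_le k h).not_gt hk
  · exact fun k hk hne => if_pos ⟨_, lt_of_le_of_ne (K.le_max' k hk) hne, K.max'_mem hK⟩
  · exact fun h => absurd (K.max'_mem hK) h
  · exact fun k hk hne => if_pos ⟨_, lt_of_le_of_ne (K.min'_le k hk) hne.symm, K.min'_mem hK⟩
  · exact fun h => absurd (K.min'_mem hK) h

/-- Up to terms of lower degree the Tutte polynomial is `(x + y) ^ n`: in the recursion at the last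
index the weights of the slices add up to `x + y` plus a constant. -/
lemma IsPolymatroid.tutte_sub_mem_lowDeg {n : ℕ} {P : Finset (Fin n → ℤ)} (hP : IsPolymatroid P) :
    tutte P - (X 0 + X 1) ^ n ∈ lowDeg n := by
  induction n with
  | zero =>
    obtain ⟨a, ha⟩ := hP.nonempty
    have : P = {a} := Finset.eq_singleton_iff_unique_mem.2 ⟨ha, fun b _ => Subsingleton.elim _ _⟩
    rw [tutte_eq_sum_prod, this]
    simp
  | succ n ih =>
    have hK : ∀ a ∈ P, a (Fin.last n) ∈ P.image (· (Fin.last n)) := fun a ha =>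
      Finset.mem_image_of_mem _ ha
    rw [hP.tutte_eq_sum_slice_last hK]
    set K := P.image (· (Fin.last n)) with hKdef
    have hS : (fun k' => ∃ b ∈ P, b (Fin.last n) = k') = (· ∈ K) := by
      funext k
      simp [hKdef]
    have hne : K.Nonempty := hP.nonempty.image _
    have hsplit : ∑ k ∈ K, endWt (fun k' => ∃ b ∈ P, b (Fin.last n) = k') k *
          tutte (PolymatroidTutte.slice P (Fin.last n) k) - (X 0 + X 1) ^ (n + 1) =
        ∑ k ∈ K, endWt (· ∈ K) k * (tutte (PolymatroidTutte.slice P (Fin.last n) k)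
          - (X 0 + X 1) ^ n) + ((K.card : ℤ) - 2) • (X 0 + X 1) ^ n := by
      rw [hS]
      simp only [mul_sub, Finset.sum_sub_distrib, ← Finset.sum_mul, sum_endWt hne, zsmul_eq_mul]
      push_cast
      ring
    rw [hsplit]
    refine add_mem (sum_mem fun k hk => endWt_mul_mem_lowDeg ?_ _ _)
      (zsmul_mem (add_pow_mem_lowDeg n) _)
    obtain ⟨a, ha, rfl⟩ := Finset.mem_image.1 hk
    exact ih (hP.slice ha rfl)

section Degree

variable {n : ℕ} {P : Finset (Fin n → ℤ)}

lemma IsPolymatroid.coeff_tutte (hP : IsPolymatroid P) {d : Fin 2 →₀ ℕ} (hd : n ≤ d.degree) :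
    coeff d (tutte P) = coeff d ((X 0 + X 1 : MvPolynomial (Fin 2) ℤ) ^ n) := by
  rw [← sub_eq_zero, ← coeff_sub]
  exact hP.tutte_sub_mem_lowDeg d hd

lemma IsPolymatroid.homogeneousComponent_tutte (hP : IsPolymatroid P) :
    homogeneousComponent n (tutte P) = (X 0 + X 1) ^ n := by
  ext d
  rw [coeff_homogeneousComponent]
  split_ifs with h
  · exact hP.coeff_tutte h.ge
  · exact ((isHomogeneous_add_pow n).coeff_eq_zero h).symm

lemma IsPolymatroid.coeff_tutte_eq_choose (hP : IsPolymatroid P) {k : ℕ} (hk : k ≤ n) :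
    coeff (Finsupp.single 0 k + Finsupp.single 1 (n - k)) (tutte P) = (n.choose k : ℤ) := by
  rw [hP.coeff_tutte (by simp only [map_add, Finsupp.degree_single]; omega), add_pow, coeff_sum]
  have hmon : ∀ m, (X 0 ^ m * X 1 ^ (n - m) * (n.choose m : MvPolynomial (Fin 2) ℤ)) =
      monomial (Finsupp.single 0 m + Finsupp.single 1 (n - m)) (n.choose m : ℤ) := by
    intro m
    rw [X_pow_eq_monomial, X_pow_eq_monomial, monomial_mul, mul_comm, ← map_natCast C,
      C_mul_monomial]
    simp
  rw [Finset.sum_eq_single k]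
  · rw [hmon, coeff_monomial, if_pos rfl]
  · intro m _ hm
    rw [hmon, coeff_monomial, if_neg]
    intro h
    exact hm (by simpa using DFunLike.congr_fun h 0)
  · intro h
    exact absurd (Finset.mem_range.2 (by omega)) h

lemma IsPolymatroid.totalDegree_tutte (hP : IsPolymatroid P) : (tutte P).totalDegree = n := by
  refine le_antisymm (Finset.sup_le fun d hd => ?_) ?_
  · by_contra! h
    have hdeg : n < d.degree := h
    exact mem_support_iff.1 hd
      ((hP.coeff_tutte hdeg.le).trans ((isHomogeneous_add_pow n).coeff_eq_zero hdeg.ne'))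
  · have h := hP.coeff_tutte_eq_choose le_rfl
    have := le_totalDegree (p := tutte P) (s := Finsupp.single 0 n + Finsupp.single 1 (n - n))
      (mem_support_iff.2 (by rw [h]; simp))
    simpa using this

end Degree

/-! ### Signs of the coefficients -/

lemma coeff_nonneg_of_map {p : MvPolynomial (Fin 2) ℤ}
    (h : p ∈ (map (σ := Fin 2) (Nat.castRingHom ℤ)).rangeS) (d : Fin 2 →₀ ℕ) : 0 ≤ coeff d p := by
  obtain ⟨q, rfl⟩ := h
  rw [coeff_map]
  simp

section Signs

variable {n : ℕ}

lemma coeff_bind₁_tutte_nonneg (P : Finset (Fin n → ℤ)) (d : Fin 2 →₀ ℕ) :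
    0 ≤ coeff d (bind₁ ![(X 0 : MvPolynomial (Fin 2) ℤ), X 1 + 1] (tutte P)) := by
  refine coeff_nonneg_of_map ⟨∑ a ∈ P, X 0 ^ (intAct P a \ extAct P a).card *
    (X 1 + 1) ^ (extAct P a \ intAct P a).card *
      (X 0 + X 1) ^ (intAct P a ∩ extAct P a).card, ?_⟩ d
  simp [tutte, ← add_assoc]

lemma coeff_bind₁_tutte_nonneg' (P : Finset (Fin n → ℤ)) (d : Fin 2 →₀ ℕ) :
    0 ≤ coeff d (bind₁ ![(X 0 + 1 : MvPolynomial (Fin 2) ℤ), X 1] (tutte P)) := by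
  refine coeff_nonneg_of_map ⟨∑ a ∈ P, (X 0 + 1) ^ (intAct P a \ extAct P a).card *
    X 1 ^ (extAct P a \ intAct P a).card *
      (X 0 + X 1) ^ (intAct P a ∩ extAct P a).card, ?_⟩ d
  simp [tutte, add_right_comm _ (1 : MvPolynomial (Fin 2) ℤ)]

lemma IsPolymatroid.exists_coeff_pos {P : Finset (Fin n → ℤ)} (hP : IsPolymatroid P) :
    ∃ d : Fin 2 →₀ ℕ, 0 < coeff d (tutte P) :=
  ⟨_, by rw [hP.coeff_tutte_eq_choose le_rfl]; simp⟩

/-- The Tutte polynomial is a multiple of `x + y - 1`, so it vanishes at `(1/2, 1/2)`, which is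
impossible for a nonzero polynomial with nonnegative coefficients. -/
lemma IsPolymatroid.exists_coeff_neg {P : Finset (Fin (n + 1) → ℤ)} (hP : IsPolymatroid P) :
    ∃ d : Fin 2 →₀ ℕ, coeff d (tutte P) < 0 := by
  by_contra! h
  have hzero : aeval (fun _ : Fin 2 => (1 / 2 : ℚ)) (tutte P) = 0 := by
    rw [tutte_eq_mul_tutteQuotient]
    simp only [map_mul, map_sub, map_add, aeval_X, map_one]
    norm_num
  rw [aeval_def, eval₂_eq] at hzero
  obtain ⟨d, hd⟩ := hP.exists_coeff_pos
  have hpos : ∀ e : Fin 2 →₀ ℕ, 0 < ∏ i ∈ e.support, (1 / 2 : ℚ) ^ e i := fun e =>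
    Finset.prod_pos fun i _ => by positivity
  have := (Finset.sum_eq_zero_iff_of_nonneg fun e _ =>
    mul_nonneg (by simpa using h e) (hpos e).le).1 hzero d (mem_support_iff.2 hd.ne')
  rcases mul_eq_zero.1 this with h' | h'
  · simp at h'
    omega
  · exact (hpos d).ne' h'

end Signs

lemma sum_image₂_of_injOn {α β γ M : Type*} [DecidableEq γ] [CommSemiring M]
    {f : α → β → γ} {s : Finset α} {t : Finset β}
    (hf : ∀ a ∈ s, ∀ b ∈ t, ∀ a' ∈ s, ∀ b' ∈ t, f a b = f a' b' → a = a' ∧ b = b') (g : γ → M) :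
    ∑ c ∈ Finset.image₂ f s t, g c = ∑ a ∈ s, ∑ b ∈ t, g (f a b) := by
  rw [← Finset.image_uncurry_product, Finset.sum_image, Finset.sum_product]
  · rfl
  · rintro ⟨a, b⟩ h ⟨a', b'⟩ h' heq
    rw [Finset.mem_coe, Finset.mem_product] at h h'
    obtain ⟨rfl, rfl⟩ := hf a h.1 b h.2 a' h'.1 b' h'.2 heq
    rfl

lemma IsPolymatroid.add_single_notMem {n : ℕ} {P : Finset (Fin n → ℤ)} (hP : IsPolymatroid P)
    {a : Fin n → ℤ} (ha : a ∈ P) (i : Fin n) {t : ℤ} (ht : t ≠ 0) : a + Pi.single i t ∉ P := by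
  intro h
  have := hP.sum_eq ha h
  simp [Finset.sum_add_distrib, ht] at this

/-! ### Direct sums -/

section DirectSum

variable {n m : ℕ} {P : Finset (Fin n → ℤ)} {Q : Finset (Fin m → ℤ)}
  {a : Fin n → ℤ} {b : Fin m → ℤ}

lemma append_injective2 :
    Function.Injective2 (Fin.append : (Fin n → ℤ) → (Fin m → ℤ) → Fin (n + m) → ℤ) := by
  intro a a' b b' h
  constructor
  · ext i
    simpa using congrFun h (Fin.castAdd m i)
  · ext i
    simpa using congrFun h (Fin.natAdd n i)

lemma append_mem_directSum : Fin.append a b ∈ directSum P Q ↔ a ∈ P ∧ b ∈ Q :=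
  Finset.mem_image₂_iff append_injective2

lemma castAdd_ne_natAdd (i : Fin n) (j : Fin m) : Fin.castAdd m i ≠ Fin.natAdd n j := by
  intro h
  have := congrArg Fin.val h
  simp at this
  omega

lemma append_add_single_left (a : Fin n → ℤ) (b : Fin m → ℤ) (i : Fin n) (t : ℤ) :
    Fin.append (a + Pi.single i t) b = Fin.append a b + Pi.single (Fin.castAdd m i) t := by
  ext k
  refine Fin.addCases (fun k => ?_) (fun k => ?_) k
  · simp [Pi.single_apply]
  · simp [(castAdd_ne_natAdd i k).symm]

lemma append_add_single_right (a : Fin n → ℤ) (b : Fin m → ℤ) (i : Fin m) (t : ℤ) :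
    Fin.append a (b + Pi.single i t) = Fin.append a b + Pi.single (Fin.natAdd n i) t := by
  ext k
  refine Fin.addCases (fun k => ?_) (fun k => ?_) k
  · simp [castAdd_ne_natAdd k i]
  · simp [Pi.single_apply]

lemma sub_single_one {n : ℕ} (a : Fin n → ℤ) (i : Fin n) :
    a - Pi.single i 1 = a + Pi.single i (-1) := by
  rw [Pi.single_neg, sub_eq_add_neg]

lemma exch_directSum_left (hb : b ∈ Q) {i j : Fin n} :
    Exch (directSum P Q) (Fin.append a b) (Fin.castAdd m i) (Fin.castAdd m j) ↔ Exch P a i j := by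
  rw [Exch, sub_single_one, ← append_add_single_left, ← append_add_single_left,
    append_mem_directSum, Exch, sub_single_one, and_iff_left hb]

lemma exch_directSum_right (ha : a ∈ P) {i j : Fin m} :
    Exch (directSum P Q) (Fin.append a b) (Fin.natAdd n i) (Fin.natAdd n j) ↔ Exch Q b i j := by
  rw [Exch, sub_single_one, ← append_add_single_right, ← append_add_single_right,
    append_mem_directSum, Exch, sub_single_one, and_iff_right ha]

lemma IsPolymatroid.not_exch_directSum (hP : IsPolymatroid P) (ha : a ∈ P) (i : Fin m)
    (j : Fin n) :
    ¬ Exch (directSum P Q) (Fin.append a b) (Fin.natAdd n i) (Fin.castAdd m j) := by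
  rw [Exch, sub_single_one, ← append_add_single_right, ← append_add_single_left,
    append_mem_directSum]
  exact fun h => hP.add_single_notMem ha j one_ne_zero h.1

lemma IsPolymatroid.not_exch_directSum' (hP : IsPolymatroid P) (ha : a ∈ P) (i : Fin m)
    (j : Fin n) :
    ¬ Exch (directSum P Q) (Fin.append a b) (Fin.castAdd m j) (Fin.natAdd n i) := by
  rw [Exch, sub_single_one, ← append_add_single_left, ← append_add_single_right,
    append_mem_directSum]
  exact fun h => hP.add_single_notMem ha j (by norm_num) h.1

lemma IsPolymatroid.directSum (hP : IsPolymatroid P) (hQ : IsPolymatroid Q) :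
    IsPolymatroid (directSum P Q) := by
  refine ⟨Finset.image₂_nonempty_iff.2 ⟨hP.nonempty, hQ.nonempty⟩, ?_⟩
  rintro _ hc _ hd i hi
  obtain ⟨a, ha, b, hb, rfl⟩ := Finset.mem_image₂.1 hc
  obtain ⟨a', ha', b', hb', rfl⟩ := Finset.mem_image₂.1 hd
  induction i using Fin.addCases with
  | left i =>
    obtain ⟨j, hj, h₁, h₂⟩ := hP.exchange a ha a' ha' i (by simpa using hi)
    exact ⟨Fin.castAdd m j, by simpa using hj, (exch_directSum_left hb).2 h₁,
      exch_iff'.1 ((exch_directSum_left hb').2 (exch_iff'.2 h₂))⟩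
  | right i =>
    obtain ⟨j, hj, h₁, h₂⟩ := hQ.exchange b hb b' hb' i (by simpa using hi)
    exact ⟨Fin.natAdd n j, by simpa using hj, (exch_directSum_right ha).2 h₁,
      exch_iff'.1 ((exch_directSum_right ha').2 (exch_iff'.2 h₂))⟩

lemma actWt_directSum_left (hb : b ∈ Q) (i : Fin n) :
    actWt (directSum P Q) (Fin.append a b) (Fin.castAdd m i) = actWt P a i := by
  have hlt : ∀ R : Fin (n + m) → Prop, (∀ j < Fin.castAdd m i, R j) ↔
      ∀ j < i, R (Fin.castAdd m j) := by
    refine fun R => ⟨fun h j hj => h _ hj, fun h j hj => ?_⟩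
    induction j using Fin.addCases with
    | left j => exact h j hj
    | right j =>
      have : n + (j : ℕ) < i := hj
      omega
  have hI : Fin.castAdd m i ∈ intAct (directSum P Q) (Fin.append a b) ↔ i ∈ intAct P a := by
    rw [mem_intAct, mem_intAct, hlt]
    simp only [exch_directSum_left hb]
  have hE : Fin.castAdd m i ∈ extAct (directSum P Q) (Fin.append a b) ↔ i ∈ extAct P a := by
    rw [mem_extAct, mem_extAct, hlt]
    simp only [exch_directSum_left hb]
  simp only [actWt, hI, hE]

lemma IsPolymatroid.actWt_directSum_right (hP : IsPolymatroid P) (ha : a ∈ P) (i : Fin m) :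
    actWt (PolymatroidTutte.directSum P Q) (Fin.append a b) (Fin.natAdd n i) = actWt Q b i := by
  have hlt : ∀ R : Fin (n + m) → Prop, (∀ j, R (Fin.castAdd m j)) →
      ((∀ j < Fin.natAdd n i, R j) ↔ ∀ j < i, R (Fin.natAdd n j)) := by
    refine fun R hR => ⟨fun h j hj => h _ (by simpa using hj), fun h j hj => ?_⟩
    induction j using Fin.addCases with
    | left j => exact hR j
    | right j => exact h j (by simpa using hj)
  have hI : Fin.natAdd n i ∈ intAct (PolymatroidTutte.directSum P Q) (Fin.append a b) ↔
      i ∈ intAct Q b := by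
    rw [mem_intAct, mem_intAct, hlt _ (hP.not_exch_directSum ha i)]
    simp only [exch_directSum_right ha]
  have hE : Fin.natAdd n i ∈ extAct (PolymatroidTutte.directSum P Q) (Fin.append a b) ↔
      i ∈ extAct Q b := by
    rw [mem_extAct, mem_extAct, hlt _ (hP.not_exch_directSum' ha i)]
    simp only [exch_directSum_right ha]
  simp only [actWt, hI, hE]

lemma IsPolymatroid.tutte_directSum (hP : IsPolymatroid P) (Q : Finset (Fin m → ℤ)) :
    tutte (PolymatroidTutte.directSum P Q) = tutte P * tutte Q := by
  rw [tutte_eq_sum_prod, PolymatroidTutte.directSum,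
    sum_image₂_of_injOn fun _ _ _ _ _ _ _ _ h => append_injective2 h, tutte_eq_sum_prod P,
    tutte_eq_sum_prod Q, Finset.sum_mul_sum]
  refine Finset.sum_congr rfl fun a ha => Finset.sum_congr rfl fun b hb => ?_
  rw [Fin.prod_univ_add]
  exact congrArg₂ _ (Finset.prod_congr rfl fun i _ => actWt_directSum_left hb i)
    (Finset.prod_congr rfl fun i _ => hP.actWt_directSum_right ha i)

end DirectSum

/-! ### Aggregated sums -/

section AggregatedSum

variable {n m : ℕ} {P : Finset (Fin (n + 1) → ℤ)} {Q : Finset (Fin (m + 1) → ℤ)}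
  {a : Fin (n + 1) → ℤ} {b : Fin (m + 1) → ℤ}

/-- The vector `(a₀ + b₀, a₁, …, b₁, …)`. -/
def agg (a : Fin (n + 1) → ℤ) (b : Fin (m + 1) → ℤ) : Fin (n + m + 1) → ℤ :=
  Fin.cons (a 0 + b 0) (Fin.append (Fin.tail a) (Fin.tail b))

/-- The index of `P ⊞ Q` given by an index of `P`. -/
def aggL (m : ℕ) (i : Fin (n + 1)) : Fin (n + m + 1) :=
  Fin.cases 0 (fun i => (Fin.castAdd m i).succ) i

/-- The index of `P ⊞ Q` given by an index of `Q`. -/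
def aggR (n : ℕ) (j : Fin (m + 1)) : Fin (n + m + 1) :=
  Fin.cases 0 (fun j => (Fin.natAdd n j).succ) j

@[simp] lemma aggL_zero : aggL (n := n) m 0 = 0 := rfl
@[simp] lemma aggR_zero : aggR (m := m) n 0 = 0 := rfl
@[simp] lemma aggL_succ (i : Fin n) : aggL m i.succ = (Fin.castAdd m i).succ := rfl
@[simp] lemma aggR_succ (j : Fin m) : aggR n j.succ = (Fin.natAdd n j).succ := rfl
@[simp] lemma agg_zero : agg a b 0 = a 0 + b 0 := rfl
@[simp] lemma agg_aggL_succ (i : Fin n) : agg a b (Fin.castAdd m i).succ = a i.succ := by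
  simp [agg, Fin.tail]
@[simp] lemma agg_aggR_succ (j : Fin m) : agg a b (Fin.natAdd n j).succ = b j.succ := by
  simp [agg, Fin.tail]

@[elab_as_elim]
lemma agg_cases {motive : Fin (n + m + 1) → Prop} (zero : motive 0)
    (left : ∀ i : Fin n, motive (aggL m i.succ)) (right : ∀ j : Fin m, motive (aggR n j.succ))
    (k : Fin (n + m + 1)) : motive k :=
  Fin.cases zero (fun k => Fin.addCases left right k) k

lemma agg_add_single_left (a : Fin (n + 1) → ℤ) (b : Fin (m + 1) → ℤ) (i : Fin (n + 1)) (t : ℤ) :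
    agg (a + Pi.single i t) b = agg a b + Pi.single (aggL m i) t := by
  ext k
  induction k using agg_cases with
  | zero => induction i using Fin.cases <;> simp [(Fin.succ_ne_zero _).symm]; ring
  | left k => induction i using Fin.cases <;> simp [Pi.single_apply]
  | right k =>
    induction i using Fin.cases <;> simp [(castAdd_ne_natAdd _ _).symm]

lemma agg_add_single_right (a : Fin (n + 1) → ℤ) (b : Fin (m + 1) → ℤ) (i : Fin (m + 1)) (t : ℤ) :
    agg a (b + Pi.single i t) = agg a b + Pi.single (aggR n i) t := by
  ext k
  induction k using agg_cases with
  | zero => induction i using Fin.cases <;> simp [(Fin.succ_ne_zero _).symm]; ring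
  | left k => induction i using Fin.cases <;> simp [castAdd_ne_natAdd]
  | right k => induction i using Fin.cases <;> simp [Pi.single_apply]

/-- The splitting of a vector of `P ⊞ Q` is determined by the coordinate sum of its first part. -/
lemma agg_inj {a a' : Fin (n + 1) → ℤ} {b b' : Fin (m + 1) → ℤ} (hsum : ∑ i, a i = ∑ i, a' i)
    (h : agg a b = agg a' b') : a = a' ∧ b = b' := by
  have ha : ∀ i : Fin n, a i.succ = a' i.succ := fun i => by
    simpa using congrFun h (aggL m i.succ)
  have hb : ∀ i : Fin m, b i.succ = b' i.succ := fun i => by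
    simpa using congrFun h (aggR n i.succ)
  have h0 : a 0 + b 0 = a' 0 + b' 0 := congrFun h 0
  rw [Fin.sum_univ_succ, Fin.sum_univ_succ] at hsum
  simp only [ha] at hsum
  have ha0 : a 0 = a' 0 := by omega
  exact ⟨funext (Fin.cases ha0 ha), funext (Fin.cases (by omega) hb)⟩

lemma agg_mem (ha : a ∈ P) (hb : b ∈ Q) : agg a b ∈ aggregatedSum P Q :=
  Finset.mem_image₂_of_mem ha hb

lemma IsPolymatroid.agg_mem_iff (hP : IsPolymatroid P) (ha : a ∈ P) {a' : Fin (n + 1) → ℤ}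
    (hsum : ∑ i, a' i = ∑ i, a i) : agg a' b ∈ aggregatedSum P Q ↔ a' ∈ P ∧ b ∈ Q := by
  refine ⟨fun h => ?_, fun h => agg_mem h.1 h.2⟩
  obtain ⟨a'', ha'', b'', hb'', h⟩ := Finset.mem_image₂.1 h
  obtain ⟨rfl, rfl⟩ := agg_inj ((hP.sum_eq ha'' ha).trans hsum.symm) h
  exact ⟨ha'', hb''⟩

lemma IsPolymatroid.exch_agg_left (hP : IsPolymatroid P) (ha : a ∈ P) (hb : b ∈ Q)
    {i j : Fin (n + 1)} :
    Exch (aggregatedSum P Q) (agg a b) (aggL m i) (aggL m j) ↔ Exch P a i j := by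
  rw [Exch, sub_single_one, ← agg_add_single_left, ← agg_add_single_left, hP.agg_mem_iff ha, Exch,
    sub_single_one, and_iff_left hb]
  simp [Finset.sum_add_distrib]

lemma IsPolymatroid.exch_agg_right (hP : IsPolymatroid P) (ha : a ∈ P)
    {i j : Fin (m + 1)} :
    Exch (aggregatedSum P Q) (agg a b) (aggR n i) (aggR n j) ↔ Exch Q b i j := by
  rw [Exch, sub_single_one, ← agg_add_single_right, ← agg_add_single_right, hP.agg_mem_iff ha rfl,
    Exch, sub_single_one, and_iff_right ha]

/-- An exchange between the two parts of `P ⊞ Q` goes through the common index `0`. -/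
lemma IsPolymatroid.exch_agg_left_right (hP : IsPolymatroid P) (ha : a ∈ P)
    {i : Fin (n + 1)} {j : Fin (m + 1)} :
    Exch (aggregatedSum P Q) (agg a b) (aggL m i) (aggR n j) ↔ Exch P a i 0 ∧ Exch Q b 0 j := by
  have : agg a b - Pi.single (aggL m i) 1 + Pi.single (aggR n j) 1 =
      agg (a - Pi.single i 1 + Pi.single 0 1) (b - Pi.single 0 1 + Pi.single j 1) := by
    rw [sub_single_one, sub_single_one, sub_single_one, agg_add_single_right, agg_add_single_right,
      agg_add_single_left, agg_add_single_left, aggL_zero, aggR_zero, Pi.single_neg (0 : Fin _)]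
    abel
  rw [Exch, this, hP.agg_mem_iff ha, Exch, Exch]
  simp [Finset.sum_add_distrib]

lemma IsPolymatroid.exch_agg_right_left (hP : IsPolymatroid P) (ha : a ∈ P)
    {i : Fin (n + 1)} {j : Fin (m + 1)} :
    Exch (aggregatedSum P Q) (agg a b) (aggR n j) (aggL m i) ↔ Exch P a 0 i ∧ Exch Q b j 0 := by
  have : agg a b - Pi.single (aggR n j) 1 + Pi.single (aggL m i) 1 =
      agg (a - Pi.single 0 1 + Pi.single i 1) (b - Pi.single j 1 + Pi.single 0 1) := by
    rw [sub_single_one, sub_single_one, sub_single_one, agg_add_single_right, agg_add_single_right,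
      agg_add_single_left, agg_add_single_left, aggL_zero, aggR_zero, Pi.single_neg (0 : Fin _)]
    abel
  rw [Exch, this, hP.agg_mem_iff ha, Exch, Exch]
  simp [Finset.sum_add_distrib]

lemma IsPolymatroid.aggregatedSum (hP : IsPolymatroid P) (hQ : IsPolymatroid Q) :
    IsPolymatroid (aggregatedSum P Q) := by
  refine ⟨Finset.image₂_nonempty_iff.2 ⟨hP.nonempty, hQ.nonempty⟩, ?_⟩
  simp only [← exch_iff']
  rintro _ hc _ hd k hk
  obtain ⟨a, ha, b, hb, rfl⟩ := Finset.mem_image₂.1 hc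
  obtain ⟨a', ha', b', hb', rfl⟩ := Finset.mem_image₂.1 hd
  change agg a' b' k < agg a b k at hk
  change ∃ j, agg a b j < agg a' b' j ∧ Exch _ (agg a b) k j ∧ Exch _ (agg a' b') j k
  -- if an exchange in one part uses the index `0` and this cannot be done in the aggregated sum,
  -- then it can be continued by an exchange in the other part
  have left : ∀ i, a' i < a i →
      ∃ j, agg a b j < agg a' b' j ∧ Exch (PolymatroidTutte.aggregatedSum P Q) (agg a b)
          (aggL m i) j ∧ Exch (PolymatroidTutte.aggregatedSum P Q) (agg a' b') j (aggL m i) := by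
    intro i hi
    obtain ⟨j, hj, h₁, h₂⟩ := hP.exchange a ha a' ha' i hi
    rw [← exch_iff'] at h₂
    by_cases hlt : agg a b (aggL m j) < agg a' b' (aggL m j)
    · exact ⟨_, hlt, (hP.exch_agg_left ha hb).2 h₁, (hP.exch_agg_left ha' hb').2 h₂⟩
    · have hj0 : j = 0 := by
        by_contra hne
        obtain ⟨j, rfl⟩ := Fin.exists_succ_eq.2 hne
        simp at hlt
        omega
      subst hj0
      simp only [aggL_zero, agg_zero] at hlt
      obtain ⟨l, hl, h₃, h₄⟩ := hQ.exchange b hb b' hb' 0 (by omega)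
      rw [← exch_iff'] at h₄
      have hl0 : l ≠ 0 := by rintro rfl; omega
      obtain ⟨l, rfl⟩ := Fin.exists_succ_eq.2 hl0
      exact ⟨_, by simpa using hl, (hP.exch_agg_left_right ha).2 ⟨h₁, h₃⟩,
        (hP.exch_agg_right_left ha').2 ⟨h₂, h₄⟩⟩
  have right : ∀ i, b' i < b i →
      ∃ j, agg a b j < agg a' b' j ∧ Exch (PolymatroidTutte.aggregatedSum P Q) (agg a b)
          (aggR n i) j ∧ Exch (PolymatroidTutte.aggregatedSum P Q) (agg a' b') j (aggR n i) := by
    intro i hi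
    obtain ⟨j, hj, h₁, h₂⟩ := hQ.exchange b hb b' hb' i hi
    rw [← exch_iff'] at h₂
    by_cases hlt : agg a b (aggR n j) < agg a' b' (aggR n j)
    · exact ⟨_, hlt, (hP.exch_agg_right ha).2 h₁, (hP.exch_agg_right ha').2 h₂⟩
    · have hj0 : j = 0 := by
        by_contra hne
        obtain ⟨j, rfl⟩ := Fin.exists_succ_eq.2 hne
        simp at hlt
        omega
      subst hj0
      simp only [aggR_zero, agg_zero] at hlt
      obtain ⟨l, hl, h₃, h₄⟩ := hP.exchange a ha a' ha' 0 (by omega)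
      rw [← exch_iff'] at h₄
      have hl0 : l ≠ 0 := by rintro rfl; omega
      obtain ⟨l, rfl⟩ := Fin.exists_succ_eq.2 hl0
      exact ⟨_, by simpa using hl, (hP.exch_agg_right_left ha).2 ⟨h₃, h₁⟩,
        (hP.exch_agg_left_right ha').2 ⟨h₄, h₂⟩⟩
  induction k using agg_cases with
  | zero =>
    rw [agg_zero, agg_zero] at hk
    by_cases h : a' 0 < a 0
    · exact left 0 h
    · exact right 0 (by omega)
  | left i => exact left i.succ (by simpa using hk)
  | right i => exact right i.succ (by simpa using hk)

lemma IsPolymatroid.actWt_agg_left (hP : IsPolymatroid P) (ha : a ∈ P) (hb : b ∈ Q) (i : Fin n) :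
    actWt (PolymatroidTutte.aggregatedSum P Q) (agg a b) (aggL m i.succ) = actWt P a i.succ := by
  have hlt : ∀ R : Fin (n + m + 1) → Prop, (∀ j < aggL m i.succ, R j) ↔
      ∀ j < i.succ, R (aggL m j) := by
    refine fun R => ⟨fun h j hj => h _ ?_, fun h j hj => ?_⟩
    · induction j using Fin.cases with
      | zero => exact Fin.succ_pos _
      | succ j => exact hj
    · induction j using agg_cases with
      | zero => exact h 0 (Fin.succ_pos _)
      | left j => exact h j.succ hj
      | right j =>
        have : n + (j : ℕ) + 1 < i + 1 := hj
        omega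
  have hI : aggL m i.succ ∈ intAct (PolymatroidTutte.aggregatedSum P Q) (agg a b) ↔
      i.succ ∈ intAct P a := by
    rw [mem_intAct, mem_intAct, hlt]
    simp only [hP.exch_agg_left ha hb]
  have hE : aggL m i.succ ∈ extAct (PolymatroidTutte.aggregatedSum P Q) (agg a b) ↔
      i.succ ∈ extAct P a := by
    rw [mem_extAct, mem_extAct, hlt]
    simp only [hP.exch_agg_left ha hb]
  simp only [actWt, hI, hE]

lemma IsPolymatroid.actWt_agg_right (hP : IsPolymatroid P) (ha : a ∈ P) (i : Fin m) :
    actWt (PolymatroidTutte.aggregatedSum P Q) (agg a b) (aggR n i.succ) = actWt Q b i.succ := by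
  have hlt : ∀ R : Fin (n + m + 1) → Prop, (R 0 → ∀ j : Fin n, R (aggL m j.succ)) →
      ((∀ j < aggR n i.succ, R j) ↔ ∀ j < i.succ, R (aggR n j)) := by
    refine fun R hR => ⟨fun h j hj => h _ ?_, fun h j hj => ?_⟩
    · induction j using Fin.cases with
      | zero => exact Fin.succ_pos _
      | succ j => simpa using hj
    · induction j using agg_cases with
      | zero => exact h 0 (Fin.succ_pos _)
      | left j => exact hR (h 0 (Fin.succ_pos _)) j
      | right j => exact h _ (by simpa using hj)
  have hI : aggR n i.succ ∈ intAct (PolymatroidTutte.aggregatedSum P Q) (agg a b) ↔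
      i.succ ∈ intAct Q b := by
    rw [mem_intAct, mem_intAct, hlt]
    · simp only [hP.exch_agg_right ha]
    · rw [← aggR_zero, hP.exch_agg_right ha]
      exact fun h j hE => h ((hP.exch_agg_right_left ha).1 hE).2
  have hE : aggR n i.succ ∈ extAct (PolymatroidTutte.aggregatedSum P Q) (agg a b) ↔
      i.succ ∈ extAct Q b := by
    rw [mem_extAct, mem_extAct, hlt]
    · simp only [hP.exch_agg_right ha]
    · rw [← aggR_zero, hP.exch_agg_right ha]
      exact fun h j hE => h ((hP.exch_agg_left_right ha).1 hE).2
  simp only [actWt, hI, hE]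

lemma actWt_zero {n : ℕ} (P : Finset (Fin (n + 1) → ℤ)) (a : Fin (n + 1) → ℤ) :
    actWt P a 0 = X 0 + X 1 - 1 := by
  rw [actWt, if_pos (zero_mem_intAct a), if_pos (zero_mem_extAct a)]
  ring

lemma IsPolymatroid.tutte_aggregatedSum (hP : IsPolymatroid P) (Q : Finset (Fin (m + 1) → ℤ)) :
    tutte (PolymatroidTutte.aggregatedSum P Q) * (X 0 + X 1 - 1) = tutte P * tutte Q := by
  have hagg : PolymatroidTutte.aggregatedSum P Q = Finset.image₂ agg P Q := rfl
  rw [tutte_eq_sum_prod (PolymatroidTutte.aggregatedSum P Q), hagg,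
    sum_image₂_of_injOn fun _ ha _ _ _ ha' _ _ h => agg_inj (hP.sum_eq ha ha') h,
    tutte_eq_sum_prod P, tutte_eq_sum_prod Q, Finset.sum_mul_sum, Finset.sum_mul]
  refine Finset.sum_congr rfl fun a ha => ?_
  rw [Finset.sum_mul]
  refine Finset.sum_congr rfl fun b hb => ?_
  change (∏ k, actWt (PolymatroidTutte.aggregatedSum P Q) (agg a b) k) * _ = _
  rw [Fin.prod_univ_succ, Fin.prod_univ_add, Fin.prod_univ_succ (actWt P a),
    Fin.prod_univ_succ (actWt Q b), actWt_zero, actWt_zero, actWt_zero]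
  have h₁ := fun i => hP.actWt_agg_left ha hb i
  have h₂ := fun i => hP.actWt_agg_right (b := b) (Q := Q) ha i
  simp only [aggL_succ, aggR_succ] at h₁ h₂
  simp only [h₁, h₂]
  ring

end AggregatedSum

/-! ### Deletion and contraction -/

section DeletionContraction

variable {n : ℕ} {P : Finset (Fin n → ℤ)}

lemma rankFn_le {hP : P.Nonempty} {a : Fin n → ℤ} (ha : a ∈ P) (I : Finset (Fin n)) :
    ∑ i ∈ I, a i ≤ rankFn P hP I :=
  Finset.le_sup' (fun a => ∑ i ∈ I, a i) ha

lemma exists_sum_eq_rankFn (hP : P.Nonempty) (I : Finset (Fin n)) :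
    ∃ a ∈ P, ∑ i ∈ I, a i = rankFn P hP I := by
  obtain ⟨a, ha, h⟩ := Finset.exists_mem_eq_sup' hP fun a => ∑ i ∈ I, a i
  exact ⟨a, ha, h.symm⟩

/-- The `i`-th coordinate ranges from `f({i}) - r_i` to `f({i})`. -/
lemma IsPolymatroid.coord_range (hP : IsPolymatroid P) (i : Fin n) {r : ℤ}
    (hr : r = rankFn P hP.nonempty {i} + rankFn P hP.nonempty (Finset.univ \ {i})
      - rankFn P hP.nonempty Finset.univ) :
    (∀ a ∈ P, a i ≤ rankFn P hP.nonempty {i}) ∧ (∃ a ∈ P, a i = rankFn P hP.nonempty {i}) ∧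
      (∀ a ∈ P, rankFn P hP.nonempty {i} - r ≤ a i) ∧
      ∃ a ∈ P, a i = rankFn P hP.nonempty {i} - r := by
  have hsplit : ∀ a : Fin n → ℤ, ∑ k ∈ Finset.univ \ {i}, a k + a i = ∑ k, a k := fun a => by
    rw [← Finset.sum_singleton a i]
    exact Finset.sum_sdiff (Finset.subset_univ _)
  have huniv : ∀ a ∈ P, ∑ k, a k = rankFn P hP.nonempty Finset.univ := fun a ha => by
    obtain ⟨b, hb, h⟩ := exists_sum_eq_rankFn hP.nonempty Finset.univ
    rw [← h, hP.sum_eq ha hb]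
  refine ⟨fun a ha => by simpa using rankFn_le (hP := hP.nonempty) ha {i}, ?_, fun a ha => ?_, ?_⟩
  · simpa using exists_sum_eq_rankFn hP.nonempty {i}
  · have h₁ := rankFn_le (hP := hP.nonempty) ha (Finset.univ \ {i})
    have h₂ := hsplit a
    have h₃ := huniv a ha
    omega
  · obtain ⟨a, ha, h₁⟩ := exists_sum_eq_rankFn hP.nonempty (Finset.univ \ {i})
    have h₂ := hsplit a
    have h₃ := huniv a ha
    exact ⟨a, ha, by omega⟩

end DeletionContraction

section

variable {n : ℕ} {P : Finset (Fin (n + 1) → ℤ)} {i : Fin (n + 1)} {M : ℤ}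

lemma slice_eq_project (h : ∀ a ∈ P, a i = M) : slice P i M = project P i := by
  rw [slice, Finset.filter_true_of_mem h]

lemma IsPolymatroid.tutte_eq_mul_project (hP : IsPolymatroid P) (h : ∀ a ∈ P, a i = M) :
    tutte P = (X 0 + X 1 - 1) * tutte (project P i) := by
  rw [hP.tutte_eq_sum_slice i (K := {M}) (by simpa using h), Finset.sum_singleton,
    slice_eq_project h, endWt, if_neg, if_neg]
  · ring
  · rintro ⟨k, hk, b, hb, rfl⟩
    exact hk.ne' (h b hb)
  · rintro ⟨k, hk, b, hb, rfl⟩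
    exact hk.ne (h b hb)

lemma IsPolymatroid.tutte_eq_deletion_add_contraction (hP : IsPolymatroid P)
    (h₁ : ∀ a ∈ P, a i ≤ M) (h₂ : ∃ a ∈ P, a i = M) (h₃ : ∀ a ∈ P, M - 1 ≤ a i)
    (h₄ : ∃ a ∈ P, a i = M - 1) :
    tutte P = X 0 * tutte (PolymatroidTutte.slice P i (M - 1)) +
      X 1 * tutte (PolymatroidTutte.slice P i M) := by
  have hK : ∀ a ∈ P, a i ∈ ({M - 1, M} : Finset ℤ) := fun a ha => by
    have := h₁ a ha
    have := h₃ a ha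
    simp only [Finset.mem_insert, Finset.mem_singleton]
    omega
  obtain ⟨a, ha, ha'⟩ := h₂
  obtain ⟨b, hb, hb'⟩ := h₄
  rw [hP.tutte_eq_sum_slice i hK, Finset.sum_pair (by omega)]
  congr 2
  · rw [endWt, if_neg, if_pos ⟨M, by omega, a, ha, ha'⟩]
    · ring
    · rintro ⟨k, hk, c, hc, rfl⟩
      exact (h₃ c hc).not_gt hk
  · rw [endWt, if_pos ⟨M - 1, by omega, b, hb, hb'⟩, if_neg]
    · ring
    · rintro ⟨k, hk, c, hc, rfl⟩
      exact (h₁ c hc).not_gt hk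

end

end PolymatroidTutte

theorem mainTheorem8 (n : ℕ) (P : Finset (Fin (n + 1) → ℤ)) (hP : IsPolymatroid P) :
    -- (a) the degree
    (tutte P).totalDegree = n + 1 ∧
    -- (b) the signs of the coefficients
    ((∀ d : Fin 2 →₀ ℕ,
        0 ≤ coeff d (bind₁ ![(X 0 : MvPolynomial (Fin 2) ℤ), X 1 + 1] (tutte P))) ∧
      (∀ d : Fin 2 →₀ ℕ,
        0 ≤ coeff d (bind₁ ![(X 0 + 1 : MvPolynomial (Fin 2) ℤ), X 1] (tutte P))) ∧
      (∃ d : Fin 2 →₀ ℕ, 0 < coeff d (tutte P)) ∧ (∃ d : Fin 2 →₀ ℕ, coeff d (tutte P) < 0)) ∧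
    -- (c) divisibility
    (X 0 + X 1 - 1) ^ codim P ∣ tutte P ∧
    -- (d) the top homogeneous component
    (homogeneousComponent (n + 1) (tutte P) = (X 0 + X 1) ^ (n + 1) ∧
      ∀ k ≤ n + 1, coeff (Finsupp.single 0 k + Finsupp.single 1 (n + 1 - k)) (tutte P) =
        ((n + 1).choose k : ℤ)) ∧
    -- (e) direct sums and aggregated sums
    (∀ (m : ℕ) (Q : Finset (Fin (m + 1) → ℤ)), IsPolymatroid Q →
      (IsPolymatroid (directSum P Q) ∧ tutte (directSum P Q) = tutte P * tutte Q) ∧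
      (IsPolymatroid (aggregatedSum P Q) ∧
        tutte (aggregatedSum P Q) * (X 0 + X 1 - 1) = tutte P * tutte Q)) ∧
    -- (f) deletion and contraction
    (∀ (f : Finset (Fin (n + 1)) → ℤ) (i : Fin (n + 1)) (r : ℤ), f = rankFn P hP.nonempty →
      r = f {i} + f (Finset.univ \ {i}) - f Finset.univ →
      (r = 0 → IsPolymatroid (project P i) ∧
        tutte P = (X 0 + X 1 - 1) * tutte (project P i)) ∧
      (r = 1 → IsPolymatroid (project {a ∈ P | a i = f {i} - 1} i) ∧
        IsPolymatroid (project {a ∈ P | a i = f {i}} i) ∧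
        tutte P = X 0 * tutte (project {a ∈ P | a i = f {i} - 1} i) +
          X 1 * tutte (project {a ∈ P | a i = f {i}} i))) ∧
    -- (g) the values at (1,1) and (0,0)
    ((latticePoints (polytope P)).Finite ∧
      eval ![1, 1] (tutte P) = (P.card : ℤ) ∧
      P.card = (latticePoints (polytope P)).ncard ∧
      eval ![0, 0] (tutte P) =
        (-1) ^ codim P * ((latticePoints (intrinsicInterior ℝ (polytope P))).ncard : ℤ)) ∧
    -- (h) Minkowski differences; R is the quotient of the Tutte polynomial by x + y - 1
    ((latticePoints (minkowskiDiff (polytope P) (simplex (n + 1)))).Finite ∧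
      (latticePoints (minkowskiDiff (polytope P) (revSimplex (n + 1)))).Finite ∧
      ∃ R : MvPolynomial (Fin 2) ℤ, tutte P = (X 0 + X 1 - 1) * R ∧
        eval ![1, 0] R =
          ((latticePoints (minkowskiDiff (polytope P) (simplex (n + 1)))).ncard : ℤ) ∧
        eval ![0, 1] R =
          ((latticePoints (minkowskiDiff (polytope P) (revSimplex (n + 1)))).ncard : ℤ)) := by
  refine ⟨hP.totalDegree_tutte, ⟨coeff_bind₁_tutte_nonneg P, coeff_bind₁_tutte_nonneg' P,
    hP.exists_coeff_pos, hP.exists_coeff_neg⟩, pow_codim_dvd_tutte P,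
    ⟨hP.homogeneousComponent_tutte, fun k hk => hP.coeff_tutte_eq_choose hk⟩,
    fun m Q hQ => ⟨⟨hP.directSum hQ, hP.tutte_directSum Q⟩,
      hP.aggregatedSum hQ, hP.tutte_aggregatedSum Q⟩, ?_, ?_, ?_⟩
  · rintro f i r rfl hr
    obtain ⟨h₁, h₂, h₃, h₄⟩ := hP.coord_range i hr
    obtain ⟨a, ha, ha'⟩ := h₂
    constructor
    · rintro rfl
      have h : ∀ b ∈ P, b i = rankFn P hP.nonempty {i} := fun b hb =>
        le_antisymm (h₁ b hb) (by simpa using h₃ b hb)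
      exact ⟨slice_eq_project h ▸ hP.slice ha ha', hP.tutte_eq_mul_project h⟩
    · rintro rfl
      obtain ⟨b, hb, hb'⟩ := h₄
      exact ⟨hP.slice hb hb', hP.slice ha ha',
        hP.tutte_eq_deletion_add_contraction h₁ ⟨a, ha, ha'⟩ h₃ ⟨b, hb, hb'⟩⟩
  · rw [hP.latticePoints_polytope]
    exact ⟨P.finite_toSet, eval_one_one_tutte P, (Set.ncard_coe_finset P).symm,
      hP.eval_zero_zero_tutte⟩
  · rw [hP.latticePoints_minkowskiDiff_simplex, hP.latticePoints_minkowskiDiff_revSimplex]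
    refine ⟨Finset.finite_toSet _, Finset.finite_toSet _, tutteQuotient P,
      tutte_eq_mul_tutteQuotient P, ?_, ?_⟩
    · rw [eval_tutteQuotient_one_zero, Set.ncard_coe_finset,
        Finset.card_image_of_injective _ (sub_left_injective)]
    · rw [eval_tutteQuotient_zero_one, Set.ncard_coe_finset,
        Finset.card_image_of_injective _ (add_left_injective _)]
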